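/- Let $n\ge 2$ and let $\mathbb{S}^n$ be the unit sphere in $\mathbb{R}^{n+1}$ with its spherical (angular) metric. Let $\mathrm{LIP}(\mathbb{S}^n)$ be the group of orientation preserving homeomorphisms $f$ of $\mathbb{S}^n$ such that $f$ and $f^{-1}$ are locally Lipschitz (equivalently, bilipschitz). Let $\mathrm{QC}(\mathbb{S}^n)$ be the group of orientation preserving quasiconformal homeomorphisms of $\mathbb{S}^n$, that is, those $f$ for which, in all stereographic charts $\varphi,\psi$, the map $F=\psi\circ f\circ\varphi^{-1}$ is locally quasiconformal where it is defined: every point of its domain has a neighbourhood $U$ and a constant $K<\infty$ such that $$\limsup_{\varepsilon\to0}\frac{\sup_{|y-x|=\varepsilon}|F(y)-F(x)|}{\inf_{|y-x|=\varepsilon}|F(y)-F(x)|}<K\qquad\text{for all }x\in U.$$ Let $\mathrm{G}(\mathbb{S}^n)$ denote either $\mathrm{LIP}(\mathbb{S}^n)$ or $\mathrm{QC}(\mathbb{S}^n)$, and let $\mathrm{G}_0(\mathbb{S}^n)$ be the set of those $g\in\mathrm{G}(\mathbb{S}^n)$ that are the identity outside some open spherical ball of radius in $(0,\pi)$. Theorem.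 Let $h\in\mathrm{G}(\mathbb{S}^n)$ with $h\neq\mathrm{id}$. Then every $g\in\mathrm{G}_0(\mathbb{S}^n)$ is a product $g=c_1\circ c_2\circ c_3\circ c_4$ in which each $c_i$ is of the form $k\circ h\circ k^{-1}$ or $k\circ h^{-1}\circ k^{-1}$ with $k\in\mathrm{G}(\mathbb{S}^n)$. -/

import Mathlib

open scoped Topology NNReal ENNReal

noncomputable section

/-- The unit sphere `𝕊ⁿ` in `ℝⁿ⁺¹`. -/
abbrev Sph (n : ℕ) : Type := Metric.sphere (0 : EuclideanSpace ℝ (Fin (n + 1))) 1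

/-- The standard spherical distance on `𝕊ⁿ`: the angle between two unit vectors. -/
def sphDist {n : ℕ} (x y : Sph n) : ℝ :=
  InnerProductGeometry.angle (x : EuclideanSpace ℝ (Fin (n + 1))) y

/-- The open ball of centre `c` and radius `r` for the spherical distance. -/
def sphBall {n : ℕ} (c : Sph n) (r : ℝ) : Set (Sph n) := {x | sphDist x c < r}

/-- The basis of open balls of radius in `(0, π)`. -/
def ballBasis (n : ℕ) : Set (Set (Sph n)) :=
  {B | ∃ c : Sph n, ∃ r ∈ Set.Ioo (0 : ℝ) Real.pi, B = sphBall c r}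

/-! ### Orientation -/

/-- A homeomorphism of `𝕊ⁿ` (with `n ≥ 1`) preserves orientation if it has degree one, that is, if it
induces the identity on the `n`-th singular homology group with integer coefficients. -/
def IsOrientationPreserving {n : ℕ} (f : Sph n ≃ₜ Sph n) : Prop :=
  ((AlgebraicTopology.singularHomologyFunctor (ModuleCat.{0} ℤ) n).obj (ModuleCat.of ℤ ℤ)).map
      (TopCat.ofHom (f : C(Sph n, Sph n))) =
    CategoryTheory.CategoryStruct.id _

/-! ### Bilipschitz homeomorphisms -/

/-- Locally Lipschitz maps of the sphere with its spherical distance. -/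
def IsSphLocallyLipschitz {n : ℕ} (f : Sph n → Sph n) : Prop :=
  ∀ x : Sph n, ∃ U ∈ 𝓝 x, ∃ L : ℝ, 0 < L ∧
    ∀ y ∈ U, ∀ z ∈ U, sphDist (f y) (f z) ≤ L * sphDist y z

/-- `LIP(𝕊ⁿ)`: the orientation preserving lipeomorphisms of `𝕊ⁿ`. -/
def LIP (n : ℕ) : Set (Sph n ≃ₜ Sph n) :=
  {f | IsSphLocallyLipschitz f ∧ IsSphLocallyLipschitz f.symm ∧ IsOrientationPreserving f}

/-! ### Quasiconformal homeomorphisms -/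

/-- The quotient `K_x(ε) = D_u(ε) / D_l(ε)` of the largest and the smallest distance from `f x` to
the image of the sphere of radius `ε` around `x`. -/
def distortion {n : ℕ} (f : EuclideanSpace ℝ (Fin n) → EuclideanSpace ℝ (Fin n))
    (x : EuclideanSpace ℝ (Fin n)) (ε : ℝ) : ℝ≥0∞ :=
  (⨆ y ∈ Metric.sphere x ε, edist (f x) (f y)) / (⨅ y ∈ Metric.sphere x ε, edist (f x) (f y))

/-- The linear dilatation `K_x = limsup_{ε → 0} K_x(ε)`. -/
def dilatation {n : ℕ} (f : EuclideanSpace ℝ (Fin n) → EuclideanSpace ℝ (Fin n))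
    (x : EuclideanSpace ℝ (Fin n)) : ℝ≥0∞ :=
  Filter.limsup (fun ε : ℝ => distortion f x ε) (𝓝[>] 0)

/-- `f` is quasiconformal on the open set `U`: `K_x < K` on `U`, for some `K < ∞`. (It is applied to
maps which are homeomorphisms from `U` onto an open set.) -/
def IsQuasiconformalOn {n : ℕ} (f : EuclideanSpace ℝ (Fin n) → EuclideanSpace ℝ (Fin n))
    (U : Set (EuclideanSpace ℝ (Fin n))) : Prop :=
  ∃ K : ℝ≥0, ∀ x ∈ U, dilatation f x < (K : ℝ≥0∞)

/-- A homeomorphism between open subsets of `ℝⁿ` is locally quasiconformal if each point of its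
domain has a neighbourhood on which it is quasiconformal. -/
def IsLocallyQuasiconformal {n : ℕ}
    (e : OpenPartialHomeomorph (EuclideanSpace ℝ (Fin n)) (EuclideanSpace ℝ (Fin n))) : Prop :=
  ∀ x ∈ e.source, ∃ U : Set (EuclideanSpace ℝ (Fin n)),
    IsOpen U ∧ x ∈ U ∧ U ⊆ e.source ∧ IsQuasiconformalOn e U

/-- `QC(𝕊ⁿ)`: the orientation preserving homeomorphisms `f` of `𝕊ⁿ` such that for all charts `φ`, `ψ`
of the standard (stereographic) atlas of `𝕊ⁿ`, the composition `ψ ∘ f ∘ φ⁻¹` is locally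
quasiconformal where it is defined. -/
def QC (n : ℕ) : Set (Sph n ≃ₜ Sph n) :=
  {f | (∀ φ ∈ atlas (EuclideanSpace ℝ (Fin n)) (Sph n),
        ∀ ψ ∈ atlas (EuclideanSpace ℝ (Fin n)) (Sph n),
          IsLocallyQuasiconformal ((φ.symm.trans f.toOpenPartialHomeomorph).trans ψ)) ∧
      IsOrientationPreserving f}

/-! ### Supports and conjugates -/

/-- The elements of `G` that are supported on a ball of the basis. -/
def supportedOnBalls {n : ℕ} (G : Set (Sph n ≃ₜ Sph n)) : Set (Sph n ≃ₜ Sph n) :=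
  {g | g ∈ G ∧ ∃ B ∈ ballBasis n, ∀ x, x ∉ B → g x = x}

/-- `b` is a conjugate of `a` by an element of `G`. -/
def IsConjIn {n : ℕ} (G : Set (Sph n ≃ₜ Sph n)) (a b : Sph n ≃ₜ Sph n) : Prop :=
  ∃ k ∈ G, b = k * a * k⁻¹

end

/-! Two classical tricks are combined.

The first is the commutator trick. If `h` moves an open set `V` off itself and `φ`, `ψ` are
supported in `V`, then `h φ⁻¹ h⁻¹` commutes with `ψ`, and so `φ ψ φ⁻¹ ψ⁻¹` can be rewritten as a
product of four conjugates of `h` and `h⁻¹` (`eq_prod_conj_of_commutator`).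

The second is an infinite repetition, which makes `g` conjugate to such a commutator. With the pole
outside the support, `g` is a homeomorphism `Γ` of bounded support of `ℝⁿ`. Shrink it into an
annulus around a point of `V`. Let `φ` carry out a copy of the result at every scale `2⁻ⁱ`, and let
`ψ` halve a ball around that point. Then `ψ φ⁻¹ ψ⁻¹` undoes all copies but the outermost one
(`FixesOffAnnulus.repeated_commutator`).

It remains to keep the conjugators in the group. For bilipschitz maps this is a Lipschitz estimate
uniform in the scale. For quasiconformal maps the proof stays with the metric definition, and the
obstacle is that a chart change does not send spheres to concentric spheres. The remedy is
`AnnularDistortion`, which compares points in annuli of thickness `O(r ^ 2)` instead of spheres.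
Such annuli are stable under dilations and stereographic charts, whose deviation from a similarity
is quadratic (`AnnularDistortion.comp_right`). That quasiconformal maps have this property follows
from using several charts: a chart with another pole controls Apollonian spheres, and these join
concentric spheres of slightly different radii (`AnnularDistortion.of_spheres`). In the conjugators
only bilipschitz maps and dilations are composed with the repeated map, and the former only on the
left.

Orientation needs no homology computation: the extensions are products of conjugates of `h` and
`h⁻¹`, and degree one defines a normal subgroup. -/

/-- The stereographic chart with pole `p` in the standard atlas of the sphere. -/
noncomputable abbrev stereoChart {n : ℕ} (p : Sph n) :
    OpenPartialHomeomorph (Sph n) (EuclideanSpace ℝ (Fin n)) :=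
  haveI := Fact.mk (@finrank_euclideanSpace_fin ℝ _ (n + 1))
  stereographic' n p

theorem mem_atlas_sph_iff {n : ℕ} (φ : OpenPartialHomeomorph (Sph n) (EuclideanSpace ℝ (Fin n))) :
    φ ∈ atlas (EuclideanSpace ℝ (Fin n)) (Sph n) ↔ ∃ p : Sph n, φ = stereoChart p :=
  Iff.rfl

/-! ### Stereographic charts, chordal distances, and extension of maps from `ℝⁿ` to the sphere -/

section Stereographic

variable {n : ℕ} (p : Sph n)

theorem stereoChart_source : (stereoChart p).source = {p}ᶜ := by simp [stereoChart]

theorem stereoChart_symm_ne (X : EuclideanSpace ℝ (Fin n)) : (stereoChart p).symm X ≠ p := by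
  have := (stereoChart p).map_target (x := X) (by simp)
  simpa [stereoChart_source] using this

@[simp]
theorem stereoChart_right_inv (X : EuclideanSpace ℝ (Fin n)) :
    stereoChart p ((stereoChart p).symm X) = X :=
  (stereoChart p).right_inv (by simp)

theorem stereoChart_left_inv {s : Sph n} (hs : s ≠ p) :
    (stereoChart p).symm (stereoChart p s) = s :=
  (stereoChart p).left_inv (by simpa [stereoChart_source] using hs)

theorem stereoChart_symm_eq :
    ∃ w : EuclideanSpace ℝ (Fin n) →ₗᵢ[ℝ] EuclideanSpace ℝ (Fin (n + 1)),
      (∀ X, inner ℝ (w X) (p : EuclideanSpace ℝ (Fin (n + 1))) = 0) ∧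
      ∀ X, ((stereoChart p).symm X : EuclideanSpace ℝ (Fin (n + 1))) =
        (‖X‖ ^ 2 + 4)⁻¹ • ((4 : ℝ) • w X + (‖X‖ ^ 2 - 4) • (p : EuclideanSpace ℝ (Fin (n + 1)))) := by
  have := Fact.mk (@finrank_euclideanSpace_fin ℝ _ (n + 1))
  let U : (ℝ ∙ (p : EuclideanSpace ℝ (Fin (n + 1))))ᗮ ≃ₗᵢ[ℝ] EuclideanSpace ℝ (Fin n) :=
    (OrthonormalBasis.fromOrthogonalSpanSingleton n (ne_zero_of_mem_unit_sphere p)).repr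
  refine ⟨(Submodule.subtypeₗᵢ _).comp U.symm.toLinearIsometry, fun X => ?_, fun X => ?_⟩
  · exact Submodule.mem_orthogonal_singleton_iff_inner_left.mp (U.symm X).2
  · have h := stereographic'_symm_apply p X
    have h2 : ‖((U.symm X : (ℝ ∙ (p : EuclideanSpace ℝ (Fin (n + 1))))ᗮ) :
      EuclideanSpace ℝ (Fin (n + 1)))‖ = ‖X‖ := by
      rw [Submodule.norm_coe, U.symm.norm_map]
    simp only at h
    rw [h]
    change (‖((U.symm X : (ℝ ∙ (p : EuclideanSpace ℝ (Fin (n + 1))))ᗮ) :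
      EuclideanSpace ℝ (Fin (n + 1)))‖ ^ 2 + 4)⁻¹ • _ + (‖((U.symm X : (ℝ ∙ (p : EuclideanSpace ℝ (Fin (n + 1))))ᗮ) :
      EuclideanSpace ℝ (Fin (n + 1)))‖ ^ 2 + 4)⁻¹ • (‖((U.symm X : (ℝ ∙ (p : EuclideanSpace ℝ (Fin (n + 1))))ᗮ) :
      EuclideanSpace ℝ (Fin (n + 1)))‖ ^ 2 - 4) • _ = _
    rw [h2, smul_add]
    rfl

theorem dist_stereoChart_symm_pole_sq (X : EuclideanSpace ℝ (Fin n)) :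
    dist ((stereoChart p).symm X) p ^ 2 * (‖X‖ ^ 2 + 4) = 16 := by
  obtain ⟨w, hw, h⟩ := stereoChart_symm_eq p
  have hp : ‖(p : EuclideanSpace ℝ (Fin (n + 1)))‖ = 1 := by simp
  have h4 : ‖X‖ ^ 2 + 4 ≠ 0 := by positivity
  rw [Subtype.dist_eq, dist_eq_norm, h]
  have : (‖X‖ ^ 2 + 4)⁻¹ • ((4 : ℝ) • w X + (‖X‖ ^ 2 - 4) • (p : EuclideanSpace ℝ (Fin (n + 1))))
      - (p : EuclideanSpace ℝ (Fin (n + 1))) = (‖X‖ ^ 2 + 4)⁻¹ • ((4 : ℝ) • w X - (8 : ℝ) • p.1) := by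
    match_scalars <;> field_simp
    ring
  rw [this, norm_smul, mul_pow, norm_sub_sq_real, norm_smul, norm_smul, inner_smul_left,
    inner_smul_right, hw, hp, w.norm_map]
  simp only [norm_inv, Real.norm_eq_abs, abs_of_pos (show 0 < ‖X‖ ^ 2 + 4 by positivity)]
  norm_num
  field_simp
  ring

theorem dist_stereoChart_symm_sq (X Y : EuclideanSpace ℝ (Fin n)) :
    dist ((stereoChart p).symm X) ((stereoChart p).symm Y) ^ 2 * ((‖X‖ ^ 2 + 4) * (‖Y‖ ^ 2 + 4))
      = 16 * dist X Y ^ 2 := by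
  obtain ⟨w, hw, h⟩ := stereoChart_symm_eq p
  have hp : ‖(p : EuclideanSpace ℝ (Fin (n + 1)))‖ = 1 := by simp
  have h4 : ‖X‖ ^ 2 + 4 ≠ 0 := by positivity
  have h5 : ‖Y‖ ^ 2 + 4 ≠ 0 := by positivity
  have hw' : ∀ X, inner ℝ (p : EuclideanSpace ℝ (Fin (n + 1))) (w X) = 0 := fun X => by
    rw [real_inner_comm, hw]
  have hX : ‖((stereoChart p).symm X : EuclideanSpace ℝ (Fin (n + 1)))‖ = 1 := by simp
  have hY : ‖((stereoChart p).symm Y : EuclideanSpace ℝ (Fin (n + 1)))‖ = 1 := by simp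
  rw [Subtype.dist_eq, dist_eq_norm, dist_eq_norm, norm_sub_sq_real, norm_sub_sq_real, hX, hY, h, h]
  simp only [inner_smul_left, inner_smul_right, inner_add_left, inner_add_right, hw, hw',
    real_inner_self_eq_norm_sq, hp, w.inner_map_map]
  simp
  field_simp
  ring

theorem dist_stereoChart_symm_pole_pos (X : EuclideanSpace ℝ (Fin n)) :
    0 < dist ((stereoChart p).symm X) p :=
  dist_pos.2 (stereoChart_symm_ne p X)

/-- Up to an isometry, the chart is the inversion of radius 2 centred at the pole, and this is the
distance formula for inversions. The later chart estimates rest on it. -/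
theorem dist_stereoChart_symm (X Y : EuclideanSpace ℝ (Fin n)) :
    4 * dist ((stereoChart p).symm X) ((stereoChart p).symm Y) =
      dist X Y * dist ((stereoChart p).symm X) p * dist ((stereoChart p).symm Y) p := by
  have h1 := dist_stereoChart_symm_pole_sq p X
  have h2 := dist_stereoChart_symm_pole_sq p Y
  have h3 := dist_stereoChart_symm_sq p X Y
  refine (pow_left_inj₀ (by positivity) (by positivity) two_ne_zero).1 ?_
  have h4 : (‖X‖ ^ 2 + 4) * (‖Y‖ ^ 2 + 4) ≠ 0 := by positivity
  refine mul_right_cancel₀ h4 ?_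
  linear_combination 16 * h3 - dist X Y ^ 2 *
    dist ((stereoChart p).symm Y) p ^ 2 * (‖Y‖ ^ 2 + 4) * h1 - dist X Y ^ 2 * 16 * h2

theorem dist_stereoChart {s t : Sph n} (hs : s ≠ p) (ht : t ≠ p) :
    dist (stereoChart p s) (stereoChart p t) * dist s p * dist t p = 4 * dist s t := by
  have := dist_stereoChart_symm p (stereoChart p s) (stereoChart p t)
  rw [stereoChart_left_inv p hs, stereoChart_left_inv p ht] at this
  exact this.symm

theorem dist_sph_le_two (s t : Sph n) : dist s t ≤ 2 := by
  rw [Subtype.dist_eq, dist_eq_norm]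
  refine (norm_sub_le _ _).trans ?_
  simp
  norm_num

theorem isOpenEmbedding_stereoChart_symm : Topology.IsOpenEmbedding (stereoChart p).symm :=
  (stereoChart p).symm.isOpenEmbedding (by simp)

theorem continuous_stereoChart_symm : Continuous (stereoChart p).symm :=
  (isOpenEmbedding_stereoChart_symm p).continuous

theorem range_stereoChart_symm : Set.range (stereoChart p).symm = {p}ᶜ := by
  ext s
  constructor
  · rintro ⟨X, rfl⟩
    exact stereoChart_symm_ne p X
  · exact fun hs => ⟨stereoChart p s, stereoChart_left_inv p hs⟩

/-- The sphere as one-point compactification, with `p` as point at infinity. -/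
noncomputable def onePointHomeoSph : OnePoint (EuclideanSpace ℝ (Fin n)) ≃ₜ Sph n :=
  OnePoint.equivOfIsEmbeddingOfRangeEq p (stereoChart p).symm
    (isOpenEmbedding_stereoChart_symm p).isEmbedding (range_stereoChart_symm p)

/-- The extension of homeomorphisms of `ℝⁿ` to the sphere, through the stereographic chart. -/
noncomputable def sphExtend :
    (EuclideanSpace ℝ (Fin n) ≃ₜ EuclideanSpace ℝ (Fin n)) →* (Sph n ≃ₜ Sph n) where
  toFun Φ := (onePointHomeoSph p).symm.trans (Φ.onePointCongr.trans (onePointHomeoSph p))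
  map_one' := by
    ext s : 1
    obtain ⟨x, rfl⟩ := (onePointHomeoSph p).surjective s
    induction x using OnePoint.rec <;> simp
  map_mul' Φ Ψ := by
    ext s : 1
    obtain ⟨x, rfl⟩ := (onePointHomeoSph p).surjective s
    induction x using OnePoint.rec <;> simp

theorem sphExtend_symm_apply (Φ : EuclideanSpace ℝ (Fin n) ≃ₜ EuclideanSpace ℝ (Fin n))
    (X : EuclideanSpace ℝ (Fin n)) :
    sphExtend p Φ ((stereoChart p).symm X) = (stereoChart p).symm (Φ X) := by
  have h : ∀ Y : EuclideanSpace ℝ (Fin n), (stereoChart p).symm Y = onePointHomeoSph p Y :=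
    fun Y => rfl
  simp [sphExtend, h]

theorem sphExtend_pole (Φ : EuclideanSpace ℝ (Fin n) ≃ₜ EuclideanSpace ℝ (Fin n)) :
    sphExtend p Φ p = p := by
  have h : onePointHomeoSph p OnePoint.infty = p := rfl
  have h2 : (onePointHomeoSph p).symm p = OnePoint.infty :=
    (Homeomorph.symm_apply_eq _).2 h.symm
  simp [sphExtend, h2, h]

theorem exists_sphExtend_eq (g : Sph n ≃ₜ Sph n) (hg : g p = p) :
    ∃ Γ : EuclideanSpace ℝ (Fin n) ≃ₜ EuclideanSpace ℝ (Fin n), sphExtend p Γ = g := by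
  have key : ∀ f : Sph n ≃ₜ Sph n, f p = p →
      (∀ X, f ((stereoChart p).symm X) ≠ p) := fun f hf X h =>
    stereoChart_symm_ne p X (f.injective (h.trans hf.symm))
  have cont : ∀ f : Sph n ≃ₜ Sph n, f p = p →
      Continuous fun X => stereoChart p (f ((stereoChart p).symm X)) := fun f hf =>
    (stereoChart p).continuousOn.comp_continuous
      (f.continuous.comp (continuous_stereoChart_symm p))
      (fun X => by simpa [stereoChart_source] using key f hf X)
  have hg' : g.symm p = p := by rw [Homeomorph.symm_apply_eq, hg]
  refine ⟨⟨⟨fun X => stereoChart p (g ((stereoChart p).symm X)),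
    fun X => stereoChart p (g.symm ((stereoChart p).symm X)), fun X => ?_, fun X => ?_⟩,
    cont g hg, cont _ hg'⟩, ?_⟩
  · dsimp only
    rw [stereoChart_left_inv p (key g hg X), Homeomorph.symm_apply_apply, stereoChart_right_inv]
  · dsimp only
    rw [stereoChart_left_inv p (key _ hg' X), Homeomorph.apply_symm_apply, stereoChart_right_inv]
  · ext s : 1
    by_cases hs : s = p
    · rw [hs, sphExtend_pole, hg]
    · rw [← stereoChart_left_inv p hs, sphExtend_symm_apply]
      exact stereoChart_left_inv p (key g hg _)

end Stereographic

/-! ### Orientation preserving homeomorphisms form a normal subgroup -/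

section Orientation

open CategoryTheory

variable {n : ℕ}

/-- The map induced on the `n`-th integral singular homology group. -/
noncomputable abbrev homologyMap (f : C(Sph n, Sph n)) :=
  ((AlgebraicTopology.singularHomologyFunctor (ModuleCat.{0} ℤ) n).obj (ModuleCat.of ℤ ℤ)).map
    (TopCat.ofHom f)

theorem homologyMap_comp (f g : C(Sph n, Sph n)) :
    homologyMap (f.comp g) = homologyMap g ≫ homologyMap f := by
  rw [homologyMap, TopCat.ofHom_comp, Functor.map_comp]

theorem homologyMap_id : homologyMap (ContinuousMap.id (Sph n)) = 𝟙 _ := by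
  rw [homologyMap, TopCat.ofHom_id, CategoryTheory.Functor.map_id]

/-- The normal subgroup of orientation preserving homeomorphisms of the sphere. -/
noncomputable def orientationSubgroup (n : ℕ) : Subgroup (Sph n ≃ₜ Sph n) where
  carrier := {f | IsOrientationPreserving f}
  one_mem' := homologyMap_id
  mul_mem' {f g} hf hg := by
    change homologyMap ((f : C(Sph n, Sph n)).comp (g : C(Sph n, Sph n))) = 𝟙 _
    have hf' : homologyMap (f : C(Sph n, Sph n)) = 𝟙 _ := hf
    have hg' : homologyMap (g : C(Sph n, Sph n)) = 𝟙 _ := hg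
    rw [homologyMap_comp, hf', hg', Category.comp_id]
  inv_mem' {f} hf := by
    have h1 : homologyMap ((f : C(Sph n, Sph n)).comp (f.symm : C(Sph n, Sph n))) = 𝟙 _ := by
      rw [← homologyMap_id]
      congr 1
      ext1 x
      simp
    have hf' : homologyMap (f : C(Sph n, Sph n)) = 𝟙 _ := hf
    rw [homologyMap_comp, hf', Category.comp_id] at h1
    exact h1

theorem mem_orientationSubgroup {f : Sph n ≃ₜ Sph n} :
    f ∈ orientationSubgroup n ↔ IsOrientationPreserving f := Iff.rfl

/-- By functoriality the conjugating map may be any homeomorphism, so conjugators of unknown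
orientation are allowed. -/
instance : (orientationSubgroup n).Normal where
  conj_mem f hf k := by
    change homologyMap (((k : C(Sph n, Sph n)).comp (f : C(Sph n, Sph n))).comp
      (k.symm : C(Sph n, Sph n))) = 𝟙 _
    have hf' : homologyMap (f : C(Sph n, Sph n)) = 𝟙 _ := hf
    rw [homologyMap_comp, homologyMap_comp, hf', Category.id_comp, ← homologyMap_comp,
      ← homologyMap_id]
    congr 1
    ext1 x
    simp

end Orientation

/-! ### A commutator as a product of four conjugates -/

/-- Replace `ψ` in the commutator by its conjugate under `h φ⁻¹ h⁻¹`, which equals `ψ`. The word `φ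
h φ⁻¹ h⁻¹ ψ h φ h⁻¹ φ⁻¹ ψ⁻¹` then splits into four conjugates after insertion of `ψ⁻¹ ψ`. -/
theorem eq_prod_conj_of_commutator {G : Type*} [Group G] {g h k φ ψ : G}
    (hg : k * g * k⁻¹ = φ * ψ * φ⁻¹ * ψ⁻¹) (hc : Commute (h * φ⁻¹ * h⁻¹) ψ) :
    g = (k⁻¹ * φ) * h * (k⁻¹ * φ)⁻¹ * (k⁻¹ * h⁻¹ * k⁻¹⁻¹) * ((k⁻¹ * ψ) * h * (k⁻¹ * ψ)⁻¹) *
      ((k⁻¹ * (ψ * φ)) * h⁻¹ * (k⁻¹ * (ψ * φ))⁻¹) := by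
  have h1 : (h * φ⁻¹ * h⁻¹) * ψ * (h * φ⁻¹ * h⁻¹)⁻¹ = ψ := by
    rw [hc.eq, mul_inv_cancel_right]
  calc g = k⁻¹ * (k * g * k⁻¹) * k := by group
    _ = k⁻¹ * (φ * ((h * φ⁻¹ * h⁻¹) * ψ * (h * φ⁻¹ * h⁻¹)⁻¹) * φ⁻¹ * ψ⁻¹) * k := by rw [hg, h1]
    _ = _ := by group

theorem Homeomorph.commute_of_fixes {X : Type*} [TopologicalSpace X] {f g : X ≃ₜ X} {A B : Set X}
    (hAB : Disjoint A B) (hf : ∀ x ∉ A, f x = x) (hg : ∀ x ∉ B, g x = x) : Commute f g := by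
  have key : ∀ {f g : X ≃ₜ X} {A B : Set X}, Disjoint A B → (∀ x ∉ A, f x = x) →
      (∀ x ∉ B, g x = x) → ∀ x ∈ A, f (g x) = g (f x) := by
    intro f g A B hAB hf hg x hx
    have h1 : f x ∈ A := by
      by_contra h
      exact h (by rwa [f.injective (hf _ h)])
    rw [hg x (hAB.notMem_of_mem_left hx), hg _ (hAB.notMem_of_mem_left h1)]
  ext x
  by_cases hx : x ∈ A
  · exact key hAB hf hg x hx
  by_cases hx' : x ∈ B
  · exact (key hAB.symm hg hf x hx').symm
  · simp [hf x hx, hg x hx']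

/-- The conjugate is supported in `h(V)`, which is disjoint from `V`. -/
theorem Homeomorph.commute_conj_of_displaces {X : Type*} [TopologicalSpace X] {φ ψ h : X ≃ₜ X}
    {V : Set X} (hV : ∀ x ∈ V, h x ∉ V) (hφ : ∀ x ∉ V, φ x = x) (hψ : ∀ x ∉ V, ψ x = x) :
    Commute (h * φ⁻¹ * h⁻¹) ψ := by
  refine Homeomorph.commute_of_fixes (A := {x | h⁻¹ x ∈ V}) (B := V) ?_ (fun x hx => ?_) hψ
  · rw [Set.disjoint_left]
    intro x hx hx'
    exact hV _ hx (by simpa using hx')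
  · have : φ.symm (h.symm x) = h.symm x := by
      rw [Homeomorph.symm_apply_eq]
      exact (hφ _ hx).symm
    simp [this]

/-! ### Distortion of thin annuli -/

section Annular

variable {X Y Z : Type*} [PseudoMetricSpace X] [PseudoMetricSpace Y] [PseudoMetricSpace Z]

/-- At small scales around `x`, the distances from `f x` to the images of two points in an annulus
around `x` of relative thickness `C` times its radius differ at most by the factor `K`. -/
def AnnularDistortion (f : X → Y) (C K : ℝ) (x : X) : Prop :=
  ∀ᶠ q : X × X in 𝓝 (x, x), |dist q.1 x - dist q.2 x| ≤ C * dist q.2 x ^ 2 →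
    dist (f q.1) (f x) ≤ K * dist (f q.2) (f x)

theorem AnnularDistortion.mono {f : X → Y} {C C' K K' : ℝ} {x : X}
    (h : AnnularDistortion f C K x) (hC : C' ≤ C) (hK : K ≤ K') : AnnularDistortion f C' K' x := by
  filter_upwards [h] with q hq hq'
  refine (hq (hq'.trans ?_)).trans ?_ <;> gcongr

theorem AnnularDistortion.congr {f g : X → Y} {C K : ℝ} {x : X}
    (h : AnnularDistortion f C K x) (hfg : f =ᶠ[𝓝 x] g) : AnnularDistortion g C K x := by
  have h1 : ∀ᶠ q : X × X in 𝓝 (x, x), f q.1 = g q.1 := hfg.prod_inl_nhds x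
  have h2 : ∀ᶠ q : X × X in 𝓝 (x, x), f q.2 = g q.2 := hfg.prod_inr_nhds x
  filter_upwards [h, h1, h2] with q hq h1 h2
  rwa [← h1, ← h2, ← hfg.self_of_nhds]

theorem eventually_dist_lt_prod (x : X) {r : ℝ} (hr : 0 < r) :
    ∀ᶠ q : X × X in 𝓝 (x, x), dist q.1 x < r ∧ dist q.2 x < r :=
  have h : ∀ᶠ y in 𝓝 x, dist y x < r := Metric.ball_mem_nhds x hr
  (h.prod_inl_nhds x).and (h.prod_inr_nhds x)

theorem exists_pos_mul_le (C : ℝ) {c : ℝ} (hc : 0 < c) : ∃ r > 0, ∀ b, 0 ≤ b → b < r → C * b ≤ c := by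
  refine ⟨c / (|C| + 1), by positivity, fun b hb hbr => ?_⟩
  have h1 : b * (|C| + 1) < c := (lt_div_iff₀ (by positivity)).1 hbr
  nlinarith [le_abs_self C]

theorem AnnularDistortion.id (C : ℝ) (x : X) : AnnularDistortion (fun y : X => y) C 2 x := by
  obtain ⟨r, hr, hrC⟩ := exists_pos_mul_le C one_pos
  filter_upwards [eventually_dist_lt_prod x hr] with q hq h
  have := hrC _ dist_nonneg hq.2
  have h3 := (abs_le.1 h).2
  nlinarith [dist_nonneg (x := q.2) (y := x)]

/-- Only the ratio `L / l` enters the bound. For stereographic charts it is 4 at every point, which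
keeps constants uniform. -/
theorem AnnularDistortion.comp_left {f : X → Y} {T : Y → Z} {C K l L : ℝ} {x : X}
    (h : AnnularDistortion f C K x) (hf : ContinuousAt f x) (hl : 0 < l) (hL : 0 ≤ L)
    (hT : ∀ᶠ w in 𝓝 (f x), l * dist w (f x) ≤ dist (T w) (T (f x)) ∧
      dist (T w) (T (f x)) ≤ L * dist w (f x)) (hK : 0 ≤ K) :
    AnnularDistortion (fun y => T (f y)) C (L * K / l) x := by
  have hT' := hf.eventually hT
  filter_upwards [h, hT'.prod_inl_nhds x,
    hT'.prod_inr_nhds x] with q hq h1 h2 hq'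
  calc dist (T (f q.1)) (T (f x)) ≤ L * dist (f q.1) (f x) := h1.2
    _ ≤ L * (K * dist (f q.2) (f x)) := by gcongr; exact hq hq'
    _ = L * K / l * (l * dist (f q.2) (f x)) := by field_simp
    _ ≤ L * K / l * dist (T (f q.2)) (T (f x)) := by gcongr; exact h2.1

/-- A similarity up to a quadratic error maps thin annuli into thin annuli. With `a`, `b` the
distances before and `a'`, `b'` after, `a ≤ 2 b` gives `|a' - b'| ≤ (m C + 5 B) b ^ 2`, and `b' ≥ m
b / 2` turns this into the condition on `C'`. -/
theorem AnnularDistortion.comp_right {f : Y → Z} {T : X → Y} {C C' K m B : ℝ} {x : X}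
    (h : AnnularDistortion f C' K (T x)) (hT : ContinuousAt T x) (hm : 0 < m) (hC : 0 ≤ C)
    (hB : 0 ≤ B) (hTx : ∀ᶠ y in 𝓝 x, |dist (T y) (T x) - m * dist y x| ≤ B * dist y x ^ 2)
    (hC' : 4 * (m * C + 5 * B) ≤ C' * m ^ 2) :
    AnnularDistortion (fun y => f (T y)) C K x := by
  have hC0 : 0 ≤ C' := by
    by_contra! h0
    have : C' * m ^ 2 < 0 := mul_neg_of_neg_of_pos h0 (by positivity)
    have : 0 ≤ 4 * (m * C + 5 * B) := by positivity
    linarith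
  obtain ⟨r, hr, hrC⟩ := exists_pos_mul_le C one_pos
  obtain ⟨r', hr', hrB⟩ := exists_pos_mul_le B (half_pos hm)
  have h1 : Filter.Tendsto (fun q : X × X => (T q.1, T q.2)) (𝓝 (x, x)) (𝓝 (T x, T x)) :=
    (hT.comp continuous_fst.continuousAt).prodMk_nhds (hT.comp continuous_snd.continuousAt)
  filter_upwards [h1.eventually h, hTx.prod_inl_nhds x,
    hTx.prod_inr_nhds x, eventually_dist_lt_prod x hr,
    eventually_dist_lt_prod x hr'] with q hq h1 h2 h3 h4 hab
  refine hq ?_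
  have h5 := hrC _ dist_nonneg h3.2
  have h6 := hrB _ dist_nonneg h4.2
  have ha : 0 ≤ dist q.1 x := dist_nonneg
  have hb : 0 ≤ dist q.2 x := dist_nonneg
  generalize dist q.1 x = a at *
  generalize dist q.2 x = b at *
  generalize dist (T q.1) (T x) = a' at *
  generalize dist (T q.2) (T x) = b' at *
  rw [abs_le] at *
  have ha2 : a ≤ 2 * b := by nlinarith
  have ha3 : a ^ 2 ≤ 4 * b ^ 2 := by nlinarith
  have hb2 : m / 2 * b ≤ b' := by nlinarith
  have hb3 : m ^ 2 / 4 * b ^ 2 ≤ b' ^ 2 := by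
    have := pow_le_pow_left₀ (by positivity) hb2 2
    linarith [show (m / 2 * b) ^ 2 = m ^ 2 / 4 * b ^ 2 by ring]
  have hb4 : (m * C + 5 * B) * b ^ 2 ≤ C' * b' ^ 2 := by
    have e1 : C' * (m ^ 2 / 4 * b ^ 2) ≤ C' * b' ^ 2 := by gcongr
    have e2 : 4 * (m * C + 5 * B) * b ^ 2 ≤ C' * m ^ 2 * b ^ 2 := by gcongr
    linarith
  have hB3 : B * a ^ 2 ≤ B * (4 * b ^ 2) := by gcongr
  have hm1 : m * (a - b) ≤ m * (C * b ^ 2) := by gcongr; exact hab.2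
  have hm2 : m * (-(C * b ^ 2)) ≤ m * (a - b) := by gcongr; exact hab.1
  constructor <;> nlinarith

/-- Uniform bounds for the distortion of thin annuli, of any relative thickness. -/
def UniformAnnular (f : X → Y) : Prop :=
  ∀ C, 0 ≤ C → ∃ K, 0 ≤ K ∧ ∀ x, AnnularDistortion f C K x

theorem IsCompact.exists_annularDistortion {f : X → Y} {C : ℝ} {S : Set X} (hS : IsCompact S)
    (h : ∀ x ∈ S, ∃ K, ∀ᶠ y in 𝓝 x, AnnularDistortion f C K y) :
    ∃ K, 0 ≤ K ∧ ∀ x ∈ S, AnnularDistortion f C K x := by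
  refine hS.induction_on (p := fun S => ∃ K, 0 ≤ K ∧ ∀ x ∈ S, AnnularDistortion f C K x)
    ⟨0, le_rfl, by simp⟩ ?_ ?_ ?_
  · rintro s t hst ⟨K, hK, h⟩
    exact ⟨K, hK, fun x hx => h x (hst hx)⟩
  · rintro s t ⟨K, hK, h⟩ ⟨K', hK', h'⟩
    refine ⟨max K K', hK.trans (le_max_left _ _), fun x hx => ?_⟩
    rcases hx with hx | hx
    · exact (h x hx).mono le_rfl (le_max_left _ _)
    · exact (h' x hx).mono le_rfl (le_max_right _ _)
  · intro x hx
    obtain ⟨K, hK⟩ := h x hx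
    exact ⟨_, mem_nhdsWithin_of_mem_nhds hK, max K 0, le_max_right _ _,
      fun y hy => AnnularDistortion.mono hy le_rfl (le_max_left _ _)⟩

end Annular

/-! ### Two families of spheres control thin annuli -/

section Zigzag

variable {E F : Type*} [NormedAddCommGroup E] [NormedSpace ℝ E] [PseudoMetricSpace F]

/-- Take `z` on the sphere of radius `b` opposite to `P`; it lies on the Apollonian sphere of ratio
`t = b / (d + b)`, where `d = dist x P`. On the connected sphere of radius `a` the distance to `P`
takes all values from `d - a` to `d + a`, and the last hypothesis says that `a / t` is at least `d -
a`. -/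
theorem exists_dist_eq_and_dist_eq (hE : 1 < Module.rank ℝ E) {x P : E} {a b : ℝ} (ha : 0 < a)
    (hb : 0 < b) (hab : a ≤ b) (had : a ≤ dist x P) (h : dist x P * (b - a) ≤ 2 * a * b) :
    ∃ t y z, 0 < t ∧ t * dist x P ≤ b ∧ dist y x = a ∧ dist z x = b ∧ dist y x = t * dist y P ∧
      dist z x = t * dist z P := by
  set d := dist x P with hd
  have hd0 : 0 < d := ha.trans_le had
  have hray : ∀ s : ℝ, dist (x + (s / d) • (x - P)) x = |s| ∧
      dist (x + (s / d) • (x - P)) P = |d + s| := by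
    intro s
    constructor
    · rw [dist_eq_norm, add_sub_cancel_left, norm_smul, ← dist_eq_norm, ← hd, Real.norm_eq_abs,
        abs_div, abs_of_pos hd0]
      field_simp
    · have : x + (s / d) • (x - P) - P = (1 + s / d) • (x - P) := by module
      rw [dist_eq_norm, this, norm_smul, ← dist_eq_norm, ← hd, Real.norm_eq_abs,
        ← abs_of_pos hd0, ← abs_mul, abs_of_pos hd0]
      congr 1
      field_simp
  have hconn := isPreconnected_sphere hE x a
  have h1 : x + (a / d) • (x - P) ∈ Metric.sphere x a := by
    rw [Metric.mem_sphere, (hray a).1, abs_of_pos ha]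
  have h2 : x + (-a / d) • (x - P) ∈ Metric.sphere x a := by
    rw [Metric.mem_sphere, (hray (-a)).1, abs_neg, abs_of_pos ha]
  have hcont : ContinuousOn (fun y => dist y P) (Metric.sphere x a) := by fun_prop
  have hmem : a * (d + b) / b ∈ Set.Icc (dist (x + (-a / d) • (x - P)) P)
      (dist (x + (a / d) • (x - P)) P) := by
    rw [(hray a).2, (hray (-a)).2, abs_of_nonneg (by linarith), abs_of_pos (by linarith)]
    constructor
    · rw [le_div_iff₀ hb]; nlinarith
    · rw [div_le_iff₀ hb]; nlinarith
  obtain ⟨y, hy, hyP⟩ := hconn.intermediate_value h2 h1 hcont hmem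
  simp only at hyP
  have hz := hray b
  rw [abs_of_pos hb, abs_of_pos (by positivity)] at hz
  refine ⟨b / (d + b), y, x + (b / d) • (x - P), by positivity, ?_, hy, hz.1, ?_, ?_⟩
  · rw [div_mul_eq_mul_div, div_le_iff₀ (by positivity)]; nlinarith
  · rw [hyP, hy]; field_simp
  · rw [hz.1, hz.2]; field_simp

/-- If `f` has distortion at most `K` on the small spheres centred at `x`, and on the small
Apollonian spheres for the points `x` and `P`, then thin annuli around `x` are distorted at most by
the factor `K ^ 3`. -/
theorem AnnularDistortion.of_spheres (hE : 1 < Module.rank ℝ E) {f : E → F} {x P : E} {K : ℝ}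
    (hK : 1 ≤ K) (hP : x ≠ P)
    (h1 : ∀ᶠ r in 𝓝[>] (0 : ℝ), ∀ y z, dist y x = r → dist z x = r →
      dist (f y) (f x) ≤ K * dist (f z) (f x))
    (h2 : ∀ᶠ t in 𝓝[>] (0 : ℝ), ∀ y z, dist y x = t * dist y P → dist z x = t * dist z P →
      dist (f y) (f x) ≤ K * dist (f z) (f x)) :
    AnnularDistortion f (1 / dist x P) (K ^ 3) x := by
  have hd : 0 < dist x P := dist_pos.2 hP
  obtain ⟨r1, hr1, h1⟩ := mem_nhdsGT_iff_exists_Ioo_subset.1 h1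
  obtain ⟨r2, hr2, h2⟩ := mem_nhdsGT_iff_exists_Ioo_subset.1 h2
  simp only [Set.mem_Ioi] at hr1 hr2
  have key : ∀ a b, 0 < a → a ≤ b → b < r1 → a ≤ dist x P → b < r2 * dist x P →
      dist x P * (b - a) ≤ 2 * a * b → ∀ y z, dist y x = a → dist z x = b →
      dist (f y) (f x) ≤ K ^ 3 * dist (f z) (f x) ∧
      dist (f z) (f x) ≤ K ^ 3 * dist (f y) (f x) := by
    intro a b ha hab hb1 had hb2 h y z hy hz
    have hb := ha.trans_le hab
    obtain ⟨t, y', z', ht, htb, hy', hz', hy't, hz't⟩ :=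
      exists_dist_eq_and_dist_eq hE ha hb hab had h
    have ea := h1 (show a ∈ Set.Ioo 0 r1 from ⟨ha, hab.trans_lt hb1⟩)
    have eb := h1 (show b ∈ Set.Ioo 0 r1 from ⟨hb, hb1⟩)
    have et := h2 (show t ∈ Set.Ioo 0 r2 from ⟨ht, lt_of_mul_lt_mul_right (htb.trans_lt hb2) hd.le⟩)
    have hK0 : 0 ≤ K := by linarith
    -- The zigzag: along one concentric sphere, across on the Apollonian sphere, then along the
    -- other concentric sphere, with a factor `K` for each.
    constructor
    · calc _ ≤ K * dist (f y') (f x) := ea _ _ hy hy'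
        _ ≤ K * (K * dist (f z') (f x)) := by gcongr; exact et _ _ hy't hz't
        _ ≤ K * (K * (K * dist (f z) (f x))) := by gcongr; exact eb _ _ hz' hz
        _ = _ := by ring
    · calc _ ≤ K * dist (f z') (f x) := eb _ _ hz hz'
        _ ≤ K * (K * dist (f y') (f x)) := by gcongr; exact et _ _ hz't hy't
        _ ≤ K * (K * (K * dist (f y) (f x))) := by gcongr; exact ea _ _ hy' hy
        _ = _ := by ring
  have hr : 0 < min (min r1 (dist x P / 2)) (r2 * dist x P) := by positivity
  filter_upwards [eventually_dist_lt_prod x hr] with q hq hab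
  simp only [lt_min_iff] at hq
  obtain ⟨⟨⟨hq1, hq2⟩, hq3⟩, ⟨hq4, hq5⟩, hq6⟩ := hq
  have ha : 0 ≤ dist q.1 x := dist_nonneg
  have hb : 0 ≤ dist q.2 x := dist_nonneg
  have hab' : |dist q.1 x - dist q.2 x| * dist x P ≤ dist q.2 x ^ 2 := by
    rwa [one_div_mul_eq_div, le_div_iff₀ hd] at hab
  rcases hb.eq_or_lt with hb0 | hb0
  · rw [← hb0] at hab'
    have : |dist q.1 x - 0| * dist x P ≤ 0 := by simpa using hab'
    have h0 : dist q.1 x = 0 := by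
      rw [sub_zero, abs_of_nonneg ha] at this
      nlinarith
    rw [dist_eq_zero] at h0
    rw [h0, dist_self]
    positivity
  rcases le_total (dist q.1 x) (dist q.2 x) with hle | hle
  · rw [abs_of_nonpos (by linarith)] at hab'
    have hb2 : dist q.2 x ≤ 2 * dist q.1 x := by nlinarith
    exact (key _ _ (by linarith) hle hq4 (by linarith) hq6 (by nlinarith) _ _ rfl rfl).1
  · rw [abs_of_nonneg (by linarith)] at hab'
    exact (key _ _ hb0 hle hq1 (by linarith) hq3 (by nlinarith) _ _ rfl rfl).2

end Zigzag

/-! ### Bilipschitz homeomorphisms, dilations and radial maps -/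

section Bilipschitz

variable {X Y : Type*} [PseudoMetricSpace X] [PseudoMetricSpace Y]

/-- Bilipschitz homeomorphisms. -/
def Homeomorph.IsBilipschitz (f : X ≃ₜ X) : Prop :=
  ∃ L : ℝ, 0 < L ∧ (∀ x y, dist (f x) (f y) ≤ L * dist x y) ∧
    ∀ x y, dist (f.symm x) (f.symm y) ≤ L * dist x y

theorem Homeomorph.IsBilipschitz.inv {f : X ≃ₜ X} (hf : f.IsBilipschitz) :
    (f⁻¹).IsBilipschitz := by
  obtain ⟨L, hL, h1, h2⟩ := hf
  exact ⟨L, hL, h2, h1⟩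

theorem Homeomorph.IsBilipschitz.mul {f g : X ≃ₜ X} (hf : f.IsBilipschitz)
    (hg : g.IsBilipschitz) : (f * g).IsBilipschitz := by
  obtain ⟨L, hL, h1, h2⟩ := hf
  obtain ⟨M, hM, h3, h4⟩ := hg
  refine ⟨L * M, by positivity, fun x y => ?_, fun x y => ?_⟩
  · calc _ ≤ L * dist (g x) (g y) := h1 _ _
      _ ≤ L * (M * dist x y) := by gcongr; exact h3 _ _
      _ = _ := by ring
  · calc _ ≤ M * dist (f.symm x) (f.symm y) := h4 _ _
      _ ≤ M * (L * dist x y) := by gcongr; exact h2 _ _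
      _ = _ := by ring

theorem Homeomorph.IsBilipschitz.one : (1 : X ≃ₜ X).IsBilipschitz :=
  ⟨1, one_pos, fun x y => by simp, fun x y => by simp [← Homeomorph.inv_apply]⟩

theorem Homeomorph.IsBilipschitz.pow {f : X ≃ₜ X} (hf : f.IsBilipschitz) (N : ℕ) :
    (f ^ N).IsBilipschitz := by
  induction N with
  | zero => exact .one
  | succ N ih => rw [pow_succ]; exact ih.mul hf

/-- The bilipschitz map is applied last; applied first, it would not respect thin annuli. -/
theorem UniformAnnular.bilipschitz_mul {Φ f : X ≃ₜ X} (hΦ : UniformAnnular Φ)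
    (hf : f.IsBilipschitz) : UniformAnnular (f * Φ : X ≃ₜ X) := by
  obtain ⟨L, hL, h1, h2⟩ := hf
  intro C hC
  obtain ⟨K, hK, h⟩ := hΦ C hC
  refine ⟨L * K / L⁻¹, by positivity, fun x => ?_⟩
  refine (h x).comp_left Φ.continuous.continuousAt (inv_pos.2 hL) hL.le
    (Filter.Eventually.of_forall fun w => ⟨?_, h1 _ _⟩) hK
  rw [inv_mul_le_iff₀ hL]
  simpa using h2 (f w) (f (Φ x))

theorem UniformAnnular.one : UniformAnnular (1 : X ≃ₜ X) :=
  fun C _ => ⟨2, zero_le_two, fun x => .id C x⟩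

end Bilipschitz

section Dilation

variable {E : Type*} [NormedAddCommGroup E] [NormedSpace ℝ E]

/-- The homeomorphism `x ↦ c + a x`. -/
noncomputable def dilationHomeo (c : E) (a : ℝ) (ha : a ≠ 0) : E ≃ₜ E :=
  (Homeomorph.smulOfNeZero a ha).trans (Homeomorph.addLeft c)

@[simp]
theorem dilationHomeo_apply (c : E) (a : ℝ) (ha : a ≠ 0) (x : E) :
    dilationHomeo c a ha x = c + a • x := rfl

@[simp]
theorem dilationHomeo_symm_apply (c : E) (a : ℝ) (ha : a ≠ 0) (x : E) :
    (dilationHomeo c a ha).symm x = a⁻¹ • (x - c) := by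
  rw [Homeomorph.symm_apply_eq, dilationHomeo_apply, smul_inv_smul₀ ha, add_sub_cancel]

theorem dist_dilationHomeo (c : E) {a : ℝ} (ha : 0 < a) (x y : E) :
    dist (dilationHomeo c a ha.ne' x) (dilationHomeo c a ha.ne' y) = a * dist x y := by
  simp [dist_smul₀, abs_of_pos ha]

theorem dist_dilationHomeo_symm (c : E) {a : ℝ} (ha : 0 < a) (x y : E) :
    dist ((dilationHomeo c a ha.ne').symm x) ((dilationHomeo c a ha.ne').symm y) =
      a⁻¹ * dist x y := by
  rw [eq_inv_mul_iff_mul_eq₀ ha.ne', ← dist_dilationHomeo c ha, Homeomorph.apply_symm_apply,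
    Homeomorph.apply_symm_apply]

theorem isBilipschitz_dilationHomeo (c : E) {a : ℝ} (ha : 0 < a) :
    (dilationHomeo c a ha.ne').IsBilipschitz := by
  refine ⟨max a a⁻¹, by positivity, fun x y => ?_, fun x y => ?_⟩
  · rw [dist_dilationHomeo c ha]; gcongr; exact le_max_left _ _
  · rw [dist_dilationHomeo_symm c ha]; gcongr; exact le_max_right _ _

/-- Since the thickness is quadratic, rescaling by `a` multiplies its constant by `a`. For
contractions `C'` stays bounded, so copies at all small scales share one `K`. -/
theorem AnnularDistortion.conj_dilation {Γ : E → E} {C C' K a : ℝ} {c x : E} (ha : 0 < a)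
    (hK : 0 ≤ K) (hC : 0 ≤ C) (hC' : 4 * a * C ≤ C')
    (h : AnnularDistortion Γ C' K ((dilationHomeo c a ha.ne').symm x))
    (hΓ : Continuous Γ) :
    AnnularDistortion (fun y => dilationHomeo c a ha.ne' (Γ ((dilationHomeo c a ha.ne').symm y)))
      C K x := by
  have h1 := h.comp_right (Homeomorph.continuous _).continuousAt (inv_pos.2 ha) hC le_rfl
    (Filter.Eventually.of_forall fun y => by rw [dist_dilationHomeo_symm c ha]; simp)
    (by
      rw [inv_pow, ← div_eq_mul_inv, le_div_iff₀ (by positivity)]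
      calc _ = 4 * a * C := by field_simp; ring
        _ ≤ C' := hC')
  have h2 := h1.comp_left (hΓ.comp (Homeomorph.continuous _)).continuousAt ha ha.le
    (T := dilationHomeo c a ha.ne') (Filter.Eventually.of_forall fun w => by
      rw [dist_dilationHomeo c ha]; exact ⟨le_rfl, le_rfl⟩) hK
  rwa [mul_div_cancel_left₀ _ ha.ne'] at h2

theorem UniformAnnular.conj_dilation {Γ : E ≃ₜ E} (hΓ : UniformAnnular Γ) (c : E) {a : ℝ}
    (ha : 0 < a) :
    UniformAnnular (dilationHomeo c a ha.ne' * Γ * (dilationHomeo c a ha.ne')⁻¹ : E ≃ₜ E) := by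
  intro C hC
  obtain ⟨K, hK, h⟩ := hΓ (4 * a * C) (by positivity)
  exact ⟨K, hK, fun x => .conj_dilation ha hK hC le_rfl (h _) Γ.continuous⟩

theorem UniformAnnular.conj_dilation_symm {Γ : E ≃ₜ E} (hΓ : UniformAnnular Γ) (c : E) {a : ℝ}
    (ha : 0 < a) :
    UniformAnnular ((dilationHomeo c a ha.ne')⁻¹ * Γ * dilationHomeo c a ha.ne' : E ≃ₜ E) := by
  have h : (dilationHomeo c a ha.ne')⁻¹ = dilationHomeo (-(a⁻¹ • c)) a⁻¹ (inv_pos.2 ha).ne' := by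
    ext x : 1
    simp [smul_sub]
    abel
  have h2 : (dilationHomeo c a ha.ne')⁻¹ * Γ * dilationHomeo c a ha.ne' =
      dilationHomeo (-(a⁻¹ • c)) a⁻¹ (inv_pos.2 ha).ne' * Γ *
        (dilationHomeo (-(a⁻¹ • c)) a⁻¹ (inv_pos.2 ha).ne')⁻¹ := by
    rw [← h, inv_inv]
  rw [h2]
  exact hΓ.conj_dilation _ (inv_pos.2 ha)

/-- The radial map with profile `m`. -/
noncomputable def radialMap (m : ℝ → ℝ) (x : E) : E := (m ‖x‖ / ‖x‖) • x

theorem norm_radialMap {m : ℝ → ℝ} (h0 : m 0 = 0) (hm : ∀ t, 0 ≤ t → 0 ≤ m t) (x : E) :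
    ‖radialMap m x‖ = m ‖x‖ := by
  rcases eq_or_ne ‖x‖ 0 with h | h
  · simp [radialMap, h, h0]
  · rw [radialMap, norm_smul, norm_div, norm_norm, Real.norm_of_nonneg (hm _ (norm_nonneg _)),
      div_mul_cancel₀ _ h]

theorem radialMap_radialMap {m m' : ℝ → ℝ} (h0 : m 0 = 0) (h0' : m' 0 = 0)
    (hm' : ∀ t, 0 ≤ t → 0 ≤ m' t) (h : ∀ t, 0 ≤ t → m (m' t) = t) (x : E) :
    radialMap m (radialMap m' x) = x := by
  rcases eq_or_ne x 0 with rfl | hx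
  · simp [radialMap]
  have hx' : ‖x‖ ≠ 0 := norm_ne_zero_iff.2 hx
  have h1 : m' ‖x‖ ≠ 0 := fun h2 => hx' (by rw [← h _ (norm_nonneg x), h2, h0])
  conv_lhs => rw [radialMap, norm_radialMap h0' hm', h _ (norm_nonneg x), radialMap, smul_smul]
  rw [div_mul_div_comm, mul_comm, div_self (mul_ne_zero h1 hx'), one_smul]

theorem dist_radialMap_le {m : ℝ → ℝ} {L : ℝ} (h0 : m 0 = 0) (hm : ∀ t, 0 ≤ t → 0 ≤ m t)
    (hL : ∀ s t, 0 ≤ s → 0 ≤ t → |m s - m t| ≤ L * |s - t|) (x y : E) :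
    dist (radialMap m x) (radialMap m y) ≤ 3 * L * dist x y := by
  have hmle : ∀ z : E, m ‖z‖ ≤ L * ‖z‖ := fun z => by
    have := hL ‖z‖ 0 (norm_nonneg _) le_rfl
    rwa [h0, sub_zero, sub_zero, abs_norm, abs_of_nonneg (hm _ (norm_nonneg _))] at this
  have hxy := abs_norm_sub_norm_le x y
  have hLxy := hL ‖x‖ ‖y‖ (norm_nonneg _) (norm_nonneg _)
  have hL0 : 0 ≤ L := by
    have := hL 1 0 zero_le_one le_rfl
    simp only [sub_zero, abs_one, mul_one] at this
    exact (abs_nonneg _).trans this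
  rw [dist_eq_norm, dist_eq_norm]
  rcases eq_or_ne y 0 with rfl | hy
  · have : ‖radialMap m x‖ ≤ L * ‖x‖ := (norm_radialMap h0 hm x).le.trans (hmle x)
    have h2 : radialMap m (0 : E) = 0 := by simp [radialMap]
    rw [h2, sub_zero, sub_zero]
    nlinarith [norm_nonneg x]
  rcases eq_or_ne x 0 with rfl | hx
  · have : ‖radialMap m y‖ ≤ L * ‖y‖ := (norm_radialMap h0 hm y).le.trans (hmle y)
    have h2 : radialMap m (0 : E) = 0 := by simp [radialMap]
    rw [h2, zero_sub, zero_sub, norm_neg, norm_neg]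
    nlinarith [norm_nonneg y]
  have hx' : ‖x‖ ≠ 0 := norm_ne_zero_iff.2 hx
  have hy' : ‖y‖ ≠ 0 := norm_ne_zero_iff.2 hy
  -- The change of the profile contributes `L`, the change of direction `2 L`.
  have e : radialMap m x - radialMap m y = ((m ‖x‖ - m ‖y‖) / ‖x‖) • x +
      (m ‖y‖ / ‖y‖) • (((‖y‖ - ‖x‖) / ‖x‖) • x + (x - y)) := by
    simp only [radialMap]
    match_scalars <;> field_simp
    ring
  have n1 : ‖((m ‖x‖ - m ‖y‖) / ‖x‖) • x‖ ≤ L * ‖x - y‖ := by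
    rw [norm_smul, norm_div, norm_norm, div_mul_cancel₀ _ hx', Real.norm_eq_abs]
    exact hLxy.trans (by gcongr)
  have n2 : ‖((‖y‖ - ‖x‖) / ‖x‖) • x + (x - y)‖ ≤ 2 * ‖x - y‖ := by
    refine (norm_add_le _ _).trans ?_
    rw [norm_smul, norm_div, norm_norm, div_mul_cancel₀ _ hx', Real.norm_eq_abs, abs_sub_comm]
    linarith
  have n3 : ‖m ‖y‖ / ‖y‖‖ ≤ L := by
    rw [norm_div, norm_norm, Real.norm_of_nonneg (hm _ (norm_nonneg _)),
      div_le_iff₀ (norm_pos_iff.2 hy)]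
    exact hmle y
  rw [e]
  refine (norm_add_le _ _).trans ?_
  rw [norm_smul (m ‖y‖ / ‖y‖)]
  calc _ ≤ L * ‖x - y‖ + L * (2 * ‖x - y‖) := by gcongr
    _ = _ := by ring

/-- The radial homeomorphism with profile `m` and inverse profile `m'`. -/
theorem exists_radial_homeomorph {m m' : ℝ → ℝ} {L : ℝ} (h0 : m 0 = 0) (h0' : m' 0 = 0)
    (hm : ∀ t, 0 ≤ t → 0 ≤ m t) (hm' : ∀ t, 0 ≤ t → 0 ≤ m' t)
    (h : ∀ t, 0 ≤ t → m (m' t) = t) (h' : ∀ t, 0 ≤ t → m' (m t) = t) (hL0 : 0 < L)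
    (hL : ∀ s t, 0 ≤ s → 0 ≤ t → |m s - m t| ≤ L * |s - t|)
    (hL' : ∀ s t, 0 ≤ s → 0 ≤ t → |m' s - m' t| ≤ L * |s - t|) :
    ∃ f : E ≃ₜ E, (∀ x, f x = radialMap m x) ∧ f.IsBilipschitz := by
  have l1 := dist_radialMap_le (E := E) h0 hm hL
  have l2 := dist_radialMap_le (E := E) h0' hm' hL'
  refine ⟨⟨⟨radialMap m, radialMap m', radialMap_radialMap h0' h0 hm h',
    radialMap_radialMap h0 h0' hm' h⟩, ?_, ?_⟩, fun x => rfl, 3 * L, by positivity, l1, l2⟩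
  · exact (LipschitzWith.of_dist_le_mul (K := ⟨3 * L, by positivity⟩) l1).continuous
  · exact (LipschitzWith.of_dist_le_mul (K := ⟨3 * L, by positivity⟩) l2).continuous

variable (E) in
/-- There is a bilipschitz homeomorphism which is a contraction by `1 / 2` on the unit ball and the
identity outside of the ball of radius `2`. -/
theorem exists_halving_homeomorph : ∃ f : E ≃ₜ E, f.IsBilipschitz ∧
    (∀ x, ‖x‖ ≤ 1 → f x = (1 / 2 : ℝ) • x) ∧ (∀ x, 2 ≤ ‖x‖ → f x = x) ∧
    ∀ x, 1 / 2 * ‖x‖ ≤ ‖f x‖ := by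
  -- Piecewise linear with slopes `1 / 2`, `3 / 2`, `1` and breaks at `1` and `2`; `m'` is its
  -- inverse.
  let m : ℝ → ℝ := fun t => max (t / 2) (min t (3 / 2 * t - 1))
  let m' : ℝ → ℝ := fun t => min (2 * t) (max t ((2 * t + 2) / 3))
  have hm0 : m 0 = 0 := by norm_num [m]
  have hm : ∀ t, 0 ≤ t → 0 ≤ m t := fun t ht => le_max_of_le_left (by linarith)
  obtain ⟨f, hf, hf'⟩ := exists_radial_homeomorph (E := E) (m := m) (m' := m') (L := 2)
    hm0 (by norm_num [m']) hm
    (fun t ht => le_min (by linarith) (le_max_of_le_left ht))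
    (fun t ht => by simp only [m, m']; grind) (fun t ht => by simp only [m, m']; grind) two_pos
    (fun s t hs ht => by simp only [m]; grind) (fun s t hs ht => by simp only [m']; grind)
  refine ⟨f, hf', fun x hx => ?_, fun x hx => ?_, fun x => ?_⟩
  · rcases eq_or_ne x 0 with rfl | h
    · simp [hf, radialMap]
    have hx' : ‖x‖ ≠ 0 := norm_ne_zero_iff.2 h
    have : m ‖x‖ = ‖x‖ / 2 := max_eq_left (min_le_of_right_le (by linarith))
    rw [hf, radialMap, this]
    congr 1
    field_simp
  · have hx' : ‖x‖ ≠ 0 := by linarith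
    have : m ‖x‖ = ‖x‖ := by
      simp only [m]
      rw [min_eq_left (by linarith), max_eq_right (by linarith)]
    rw [hf, radialMap, this, div_self hx', one_smul]
  · rw [hf, norm_radialMap hm0 hm]
    exact le_max_of_le_left (by linarith)

end Dilation

/-! ### Infinite repetition of a homeomorphism supported in an annulus -/

section Swindle

set_option linter.unusedSectionVars false

variable {E : Type*} [NormedAddCommGroup E] [NormedSpace ℝ E]

/-- The map is the identity outside of the annulus of radii `5 / 16` and `7 / 16`. -/
def FixesOffAnnulus (Γ : E → E) : Prop :=
  ∀ x, ¬ (5 / 16 < ‖x‖ ∧ ‖x‖ < 7 / 16) → Γ x = x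

/-- The copy of the displacement of `Γ` at the scale `2⁻ⁱ`. -/
noncomputable def scaledDisplacement (Γ : E → E) (i : ℕ) (x : E) : E :=
  ((2 : ℝ) ^ i)⁻¹ • (Γ ((2 : ℝ) ^ i • x) - (2 : ℝ) ^ i • x)

/-- The map which repeats `Γ` at all scales `2⁻ⁱ`. -/
noncomputable def repeated (Γ : E → E) (x : E) : E := x + ∑' i, scaledDisplacement Γ i x

theorem norm_two_pow_smul (i : ℕ) (x : E) : ‖(2 : ℝ) ^ i • x‖ = 2 ^ i * ‖x‖ := by
  rw [norm_smul, norm_pow, Real.norm_ofNat]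

theorem add_scaledDisplacement (Γ : E → E) (i : ℕ) (x : E) :
    x + scaledDisplacement Γ i x = ((2 : ℝ) ^ i)⁻¹ • Γ ((2 : ℝ) ^ i • x) := by
  rw [scaledDisplacement, smul_sub, inv_smul_smul₀ (by positivity), add_sub_cancel]

theorem FixesOffAnnulus.scaledDisplacement_eq_zero {Γ : E → E} (hΓ : FixesOffAnnulus Γ) {i : ℕ}
    {x : E} (h : ¬ (5 / 16 < 2 ^ i * ‖x‖ ∧ 2 ^ i * ‖x‖ < 7 / 16)) :
    scaledDisplacement Γ i x = 0 := by
  rw [scaledDisplacement, hΓ _ (by rwa [norm_two_pow_smul]), sub_self, smul_zero]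

/-- The point `x` can only be in the `i`-th annulus. -/
def InScale (i : ℕ) (x : E) : Prop := 7 / 32 < 2 ^ i * ‖x‖ ∧ (2 ^ i * ‖x‖ < 5 / 8 ∨ i = 0)

theorem isOpen_setOf_inScale (i : ℕ) : IsOpen {x : E | InScale i x} := by
  have h1 : IsOpen {x : E | 7 / 32 < 2 ^ i * ‖x‖} := isOpen_lt (by fun_prop) (by fun_prop)
  refine h1.inter ?_
  change IsOpen {x : E | 2 ^ i * ‖x‖ < 5 / 8 ∨ i = 0}
  by_cases h : i = 0
  · simp [h]
  · have : IsOpen {x : E | 2 ^ i * ‖x‖ < 5 / 8} := isOpen_lt (by fun_prop) (by fun_prop)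
    simpa [h] using this

/-- The window of scale `i` runs from `7 / 32`, where annulus `i + 1` ends, to `5 / 8`, where
annulus `i - 1` begins; scale `0` has no outer neighbour. The windows overlap, so the least `i`
beyond the lower bound works. -/
theorem exists_inScale {x : E} (hx : x ≠ 0) : ∃ i, InScale i x := by
  have hx' : 0 < ‖x‖ := norm_pos_iff.2 hx
  have hex : ∃ i : ℕ, 7 / 32 < 2 ^ i * ‖x‖ := by
    obtain ⟨i, hi⟩ := pow_unbounded_of_one_lt (7 / 32 / ‖x‖) (one_lt_two (α := ℝ))
    exact ⟨i, (div_lt_iff₀ hx').1 hi⟩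
  classical
  refine ⟨Nat.find hex, Nat.find_spec hex, ?_⟩
  rcases Nat.eq_zero_or_eq_succ_pred (Nat.find hex) with h | h
  · exact Or.inr h
  · left
    have := Nat.find_min hex (m := (Nat.find hex).pred) (by omega)
    rw [h, pow_succ]
    linarith

theorem InScale.scaledDisplacement_eq_zero {Γ : E → E} (hΓ : FixesOffAnnulus Γ) {i j : ℕ} {x : E}
    (h : InScale i x) (hj : j ≠ i) : scaledDisplacement Γ j x = 0 := by
  refine hΓ.scaledDisplacement_eq_zero ?_
  have hx := norm_nonneg x
  rcases lt_or_gt_of_ne hj with hlt | hlt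
  · have h2 : 2 ^ i * ‖x‖ < 5 / 8 := h.2.resolve_right (by omega)
    have h3 : (2 : ℝ) ^ (j + 1) ≤ 2 ^ i := pow_le_pow_right₀ one_le_two hlt
    have h4 : (2 : ℝ) ^ (j + 1) * ‖x‖ ≤ 2 ^ i * ‖x‖ := by gcongr
    rw [pow_succ] at h4
    intro h5
    linarith [h5.1]
  · have h3 : (2 : ℝ) ^ (i + 1) ≤ 2 ^ j := pow_le_pow_right₀ one_le_two hlt
    have h4 : (2 : ℝ) ^ (i + 1) * ‖x‖ ≤ 2 ^ j * ‖x‖ := by gcongr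
    rw [pow_succ] at h4
    intro h5
    linarith [h5.2, h.1]

theorem FixesOffAnnulus.exists_scale {Γ : E → E} (hΓ : FixesOffAnnulus Γ) (x : E) :
    ∃ i, repeated Γ x = x + scaledDisplacement Γ i x ∧ ∀ j ≠ i, scaledDisplacement Γ j x = 0 := by
  have key : ∀ i, (∀ j ≠ i, scaledDisplacement Γ j x = 0) →
      repeated Γ x = x + scaledDisplacement Γ i x := fun i hi => by
    rw [repeated, tsum_eq_single i hi]
  rcases eq_or_ne x 0 with rfl | hx
  · have : ∀ j ≠ 0, scaledDisplacement Γ j (0 : E) = 0 := fun j _ =>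
      hΓ.scaledDisplacement_eq_zero (by norm_num)
    exact ⟨0, key 0 this, this⟩
  · obtain ⟨i, hi⟩ := exists_inScale hx
    have : ∀ j ≠ i, scaledDisplacement Γ j x = 0 := fun j hj => hi.scaledDisplacement_eq_zero hΓ hj
    exact ⟨i, key i this, this⟩

theorem FixesOffAnnulus.repeated_eq {Γ : E → E} (hΓ : FixesOffAnnulus Γ) {i : ℕ} {x : E}
    (h : InScale i x) : repeated Γ x = ((2 : ℝ) ^ i)⁻¹ • Γ ((2 : ℝ) ^ i • x) := by
  rw [repeated, tsum_eq_single i (fun j hj => h.scaledDisplacement_eq_zero hΓ hj),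
    add_scaledDisplacement]

theorem FixesOffAnnulus.repeated_zero {Γ : E → E} (hΓ : FixesOffAnnulus Γ) :
    repeated Γ 0 = 0 := by
  obtain ⟨i, hi, -⟩ := hΓ.exists_scale 0
  rw [hi, hΓ.scaledDisplacement_eq_zero (by norm_num), add_zero]

theorem FixesOffAnnulus.repeated_eq_self {Γ : E → E} (hΓ : FixesOffAnnulus Γ) {x : E}
    (hx : 7 / 16 ≤ ‖x‖) : repeated Γ x = x := by
  have h : InScale 0 x := ⟨by simp; linarith, Or.inr rfl⟩
  rw [hΓ.repeated_eq h]
  simpa using hΓ x (by simp [hx])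

theorem FixesOffAnnulus.mapsTo {Γ : E ≃ₜ E} (hΓ : FixesOffAnnulus Γ) {x : E}
    (hx : 5 / 16 < ‖x‖ ∧ ‖x‖ < 7 / 16) : 5 / 16 < ‖Γ x‖ ∧ ‖Γ x‖ < 7 / 16 := by
  by_contra h
  rw [Γ.injective (hΓ _ h)] at h
  exact h hx

theorem FixesOffAnnulus.symm {Γ : E ≃ₜ E} (hΓ : FixesOffAnnulus Γ) : FixesOffAnnulus Γ.symm :=
  fun x hx => (Homeomorph.symm_apply_eq _).2 (hΓ x hx).symm

/-- Either a point is fixed, or it and its image are in the same annulus. -/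
theorem FixesOffAnnulus.repeated_cases {Γ : E ≃ₜ E} (hΓ : FixesOffAnnulus Γ) (x : E) :
    repeated Γ x = x ∨ ∃ i : ℕ, (5 / 16 < 2 ^ i * ‖x‖ ∧ 2 ^ i * ‖x‖ < 7 / 16) ∧
      (5 / 16 < 2 ^ i * ‖repeated Γ x‖ ∧ 2 ^ i * ‖repeated Γ x‖ < 7 / 16) := by
  obtain ⟨i, hi, -⟩ := hΓ.exists_scale x
  by_cases h : 5 / 16 < 2 ^ i * ‖x‖ ∧ 2 ^ i * ‖x‖ < 7 / 16
  · refine Or.inr ⟨i, h, ?_⟩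
    rw [hi, add_scaledDisplacement, ← norm_two_pow_smul, smul_inv_smul₀ (by positivity)]
    exact hΓ.mapsTo (by rwa [norm_two_pow_smul])
  · left
    rw [hi, hΓ.scaledDisplacement_eq_zero h, add_zero]

theorem inScale_of_mem_annulus {i : ℕ} {x : E} (h : 5 / 16 < 2 ^ i * ‖x‖ ∧ 2 ^ i * ‖x‖ < 7 / 16) :
    InScale i x := ⟨by linarith [h.1], Or.inl (by linarith [h.2])⟩

theorem FixesOffAnnulus.repeated_symm_repeated {Γ : E ≃ₜ E} (hΓ : FixesOffAnnulus Γ) (x : E) :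
    repeated Γ.symm (repeated Γ x) = x := by
  rcases eq_or_ne x 0 with rfl | hx
  · rw [hΓ.repeated_zero, hΓ.symm.repeated_zero]
  obtain ⟨i, hi⟩ := exists_inScale hx
  have h1 := hΓ.repeated_eq hi
  have h2 : InScale i (repeated Γ x) := by
    by_cases h : 5 / 16 < 2 ^ i * ‖x‖ ∧ 2 ^ i * ‖x‖ < 7 / 16
    · apply inScale_of_mem_annulus
      rw [h1, ← norm_two_pow_smul, smul_inv_smul₀ (by positivity)]
      exact hΓ.mapsTo (by rwa [norm_two_pow_smul])
    · rw [← norm_two_pow_smul] at h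
      rwa [h1, hΓ _ h, inv_smul_smul₀ (by positivity)]
  rw [hΓ.symm.repeated_eq h2, h1, smul_inv_smul₀ (by positivity), Γ.symm_apply_apply,
    inv_smul_smul₀ (by positivity)]

/-- Halving shifts the series by one index, and only the copy at scale `1` is left unmatched. -/
theorem repeated_half (Γ : E ≃ₜ E) (hΓ : FixesOffAnnulus Γ) (x : E) :
    repeated Γ ((1 / 2 : ℝ) • x) =
      (1 / 2 : ℝ) • repeated Γ x + scaledDisplacement Γ 0 ((1 / 2 : ℝ) • x) := by
  have hs : ∀ i, scaledDisplacement Γ (i + 1) ((1 / 2 : ℝ) • x) =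
      (1 / 2 : ℝ) • scaledDisplacement Γ i x := fun i => by
    rw [scaledDisplacement, scaledDisplacement, smul_smul ((2 : ℝ) ^ (i + 1)), smul_smul (1 / 2 : ℝ)]
    congr 1
    · rw [pow_succ, mul_inv]; ring
    · rw [pow_succ, mul_assoc, mul_one_div_cancel two_ne_zero, mul_one]
  obtain ⟨i, -, hi⟩ := hΓ.exists_scale ((1 / 2 : ℝ) • x)
  rw [repeated, repeated, (summable_of_ne_finset_zero (s := {i}) fun j hj =>
    hi j (by simpa using hj)).tsum_eq_zero_add, smul_add]
  simp_rw [hs]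
  rw [tsum_const_smul'']
  abel

/-- The displacement at each scale is Lipschitz with the same constant `L + 1`, and at most two
scales matter for a given pair of points. -/
theorem FixesOffAnnulus.dist_repeated_le {Γ : E → E} (hΓ : FixesOffAnnulus Γ) {L : ℝ} (hL0 : 0 ≤ L)
    (hL : ∀ x y, dist (Γ x) (Γ y) ≤ L * dist x y) (x y : E) :
    dist (repeated Γ x) (repeated Γ y) ≤ (1 + 2 * (L + 1)) * dist x y := by
  have hu : ∀ i, ‖scaledDisplacement Γ i x - scaledDisplacement Γ i y‖ ≤ (L + 1) * ‖x - y‖ := by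
    intro i
    have h2 : (0 : ℝ) < 2 ^ i := by positivity
    have e : scaledDisplacement Γ i x - scaledDisplacement Γ i y = ((2 : ℝ) ^ i)⁻¹ •
        ((Γ ((2 : ℝ) ^ i • x) - Γ ((2 : ℝ) ^ i • y)) - (2 : ℝ) ^ i • (x - y)) := by
      simp only [scaledDisplacement, ← smul_sub]
      congr 1
      rw [smul_sub]
      abel
    have h3 := hL ((2 : ℝ) ^ i • x) ((2 : ℝ) ^ i • y)
    rw [dist_eq_norm, dist_eq_norm, ← smul_sub, norm_two_pow_smul] at h3
    rw [e, norm_smul, norm_inv, norm_pow, Real.norm_ofNat, inv_mul_le_iff₀ h2]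
    refine (norm_sub_le _ _).trans ?_
    rw [norm_two_pow_smul]
    linarith
  obtain ⟨i, hi, hi'⟩ := hΓ.exists_scale x
  obtain ⟨j, hj, hj'⟩ := hΓ.exists_scale y
  rw [dist_eq_norm, dist_eq_norm, hi, hj]
  have hxy := norm_nonneg (x - y)
  by_cases hij : i = j
  · subst hij
    rw [add_sub_add_comm]
    refine (norm_add_le _ _).trans ?_
    have := hu i
    nlinarith [mul_nonneg hL0 hxy]
  · have h1 := hu i
    have h2 := hu j
    rw [hj' i hij, sub_zero] at h1
    rw [hi' j (Ne.symm hij), zero_sub, norm_neg] at h2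
    rw [add_sub_add_comm]
    refine (norm_add_le _ _).trans ?_
    have := norm_sub_le (scaledDisplacement Γ i x) (scaledDisplacement Γ j y)
    linarith

variable [CompleteSpace E]

theorem FixesOffAnnulus.continuous_repeated {Γ : E ≃ₜ E} (hΓ : FixesOffAnnulus Γ) :
    Continuous (repeated Γ) := by
  refine continuous_id.add (continuous_tsum (u := fun i => (1 / 2 : ℝ) ^ i) (fun i => ?_)
    summable_geometric_two fun i x => ?_)
  · have := Γ.continuous
    unfold scaledDisplacement
    fun_prop
  · rw [scaledDisplacement, norm_smul, norm_inv, norm_pow, Real.norm_ofNat, one_div, inv_pow]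
    refine mul_le_of_le_one_right (by positivity) ?_
    generalize (2 : ℝ) ^ i • x = y
    by_cases h : 5 / 16 < ‖y‖ ∧ ‖y‖ < 7 / 16
    · refine (norm_sub_le _ _).trans ?_
      linarith [h.2, (hΓ.mapsTo h).2]
    · rw [hΓ y h, sub_self, norm_zero]
      exact zero_le_one

/-- The homeomorphism which repeats `Γ` at all scales `2⁻ⁱ`. -/
noncomputable def repeatedHomeo (Γ : E ≃ₜ E) (hΓ : FixesOffAnnulus Γ) : E ≃ₜ E where
  toFun := repeated Γ
  invFun := repeated Γ.symm
  left_inv := hΓ.repeated_symm_repeated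
  right_inv := hΓ.symm.repeated_symm_repeated
  continuous_toFun := hΓ.continuous_repeated
  continuous_invFun := hΓ.symm.continuous_repeated

/-- Write the claim as `φ ψ = Γ ψ φ`, with `φ` the repeated map. On the ball of radius `1 / 2`,
where `ψ` halves, this is `repeated_half`. Outside, `φ` fixes `x`, and `‖ψ x‖ > 1 / 4` exceeds `7 /
32`, so that `φ` acts as `Γ` at `ψ x`. -/
theorem FixesOffAnnulus.repeated_commutator {Γ ψ : E ≃ₜ E} (hΓ : FixesOffAnnulus Γ)
    (h1 : ∀ x, ‖x‖ ≤ 1 / 2 → ψ x = (1 / 2 : ℝ) • x) (h2 : ∀ x, 1 / 2 * ‖x‖ ≤ ‖ψ x‖) :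
    repeatedHomeo Γ hΓ * ψ * (repeatedHomeo Γ hΓ)⁻¹ * ψ⁻¹ = Γ := by
  rw [mul_inv_eq_iff_eq_mul, mul_inv_eq_iff_eq_mul]
  ext x : 1
  change repeated Γ (ψ x) = Γ (ψ (repeated Γ x))
  by_cases hx : ‖x‖ ≤ 1 / 2
  · have hφ : ‖repeated Γ x‖ ≤ 1 / 2 := by
      rcases hΓ.repeated_cases x with h | ⟨i, -, h⟩
      · rwa [h]
      · have : (1 : ℝ) ≤ 2 ^ i := one_le_pow₀ one_le_two
        nlinarith [norm_nonneg (repeated Γ x), h.2]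
    rw [h1 x hx, h1 _ hφ, repeated_half Γ hΓ]
    have e : ∀ y : E, scaledDisplacement Γ 0 y = Γ y - y := fun y => by simp [scaledDisplacement]
    rcases hΓ.repeated_cases x with h | ⟨i, h, h'⟩
    · rw [h, e, add_sub_cancel]
    · have h3 : (1 : ℝ) ≤ 2 ^ i := one_le_pow₀ one_le_two
      have h4 : ‖(1 / 2 : ℝ) • x‖ ≤ 5 / 16 := by
        rw [norm_smul, Real.norm_of_nonneg (by norm_num)]
        nlinarith [norm_nonneg x, h.2]
      have h5 : ‖(1 / 2 : ℝ) • repeated Γ x‖ ≤ 5 / 16 := by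
        rw [norm_smul, Real.norm_of_nonneg (by norm_num)]
        nlinarith [norm_nonneg (repeated Γ x), h'.2]
      rw [e, hΓ _ fun h6 => h4.not_gt h6.1, hΓ _ fun h6 => h5.not_gt h6.1, sub_self, add_zero]
  · have h3 := h2 x
    have h4 : InScale 0 (ψ x) := ⟨by simp; linarith, Or.inr rfl⟩
    rw [hΓ.repeated_eq_self (by linarith : 7 / 16 ≤ ‖x‖), hΓ.repeated_eq h4]
    simp

theorem Homeomorph.IsBilipschitz.repeatedHomeo {Γ : E ≃ₜ E} (h : Γ.IsBilipschitz)
    (hΓ : FixesOffAnnulus Γ) : (repeatedHomeo Γ hΓ).IsBilipschitz := by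
  obtain ⟨L, hL, h1, h2⟩ := h
  exact ⟨1 + 2 * (L + 1), by positivity, hΓ.dist_repeated_le hL.le h1,
    hΓ.symm.dist_repeated_le hL.le h2⟩

/-- Away from `0` the map is locally a conjugate of `Γ` by a contraction, with bounds independent of
the scale. At the accumulation point `0`, a moved point and its image lie in the same annulus, so
their norms agree up to the factor `7 / 5`. -/
theorem UniformAnnular.repeatedHomeo {Γ : E ≃ₜ E} (h : UniformAnnular Γ) (hΓ : FixesOffAnnulus Γ) :
    UniformAnnular (repeatedHomeo Γ hΓ) := by
  intro C hC
  obtain ⟨K, hK, h⟩ := h (4 * C) (by positivity)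
  refine ⟨max K (7 / 5 * 2 / (5 / 7)), by positivity, fun x => ?_⟩
  rcases eq_or_ne x 0 with rfl | hx
  · refine ((AnnularDistortion.id C 0).comp_left (T := repeated Γ) continuousAt_id
      (by norm_num : (0 : ℝ) < 5 / 7) (by norm_num : (0 : ℝ) ≤ 7 / 5)
      (Filter.Eventually.of_forall fun w => ?_) zero_le_two).mono le_rfl (le_max_right _ _)
    rw [hΓ.repeated_zero, dist_zero_right, dist_zero_right]
    rcases hΓ.repeated_cases w with h | ⟨i, h, h'⟩
    · rw [h]
      constructor <;> linarith [norm_nonneg w]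
    · have h2 : (0 : ℝ) < 2 ^ i := by positivity
      constructor
      · refine le_of_mul_le_mul_left ?_ h2
        linarith [h.2, h'.1]
      · refine le_of_mul_le_mul_left ?_ h2
        linarith [h.1, h'.2]
  · obtain ⟨i, hi⟩ := exists_inScale hx
    have h2 : (1 : ℝ) ≤ 2 ^ i := one_le_pow₀ one_le_two
    have h3 : (0 : ℝ) < ((2 : ℝ) ^ i)⁻¹ := by positivity
    have h4 := AnnularDistortion.conj_dilation (c := (0 : E)) (x := x) (C := C) (C' := 4 * C) h3 hK
      hC ?_ (h _) Γ.continuous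
    · refine (h4.mono le_rfl (le_max_left _ _)).congr ?_
      filter_upwards [(isOpen_setOf_inScale i).mem_nhds hi] with y hy
      rw [dilationHomeo_symm_apply, dilationHomeo_apply, inv_inv, sub_zero, zero_add]
      exact (hΓ.repeated_eq hy).symm
    · have : ((2 : ℝ) ^ i)⁻¹ ≤ 1 := inv_le_one_of_one_le₀ h2
      nlinarith

end Swindle

/-! ### Homeomorphisms of bounded support are conjugate to commutators in a small ball -/

section Commutator

variable {E : Type*} [NormedAddCommGroup E]

/-- The homeomorphism is the identity outside of a bounded set. -/
def Homeomorph.HasBoundedSupport (f : E ≃ₜ E) : Prop := ∃ R, ∀ x, R ≤ ‖x‖ → f x = x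

theorem Homeomorph.HasBoundedSupport.one : (1 : E ≃ₜ E).HasBoundedSupport :=
  ⟨0, fun _ _ => rfl⟩

theorem Homeomorph.HasBoundedSupport.inv {f : E ≃ₜ E} (hf : f.HasBoundedSupport) :
    (f⁻¹).HasBoundedSupport := by
  obtain ⟨R, h⟩ := hf
  exact ⟨R, fun x hx => (Homeomorph.symm_apply_eq _).2 (h x hx).symm⟩

theorem Homeomorph.HasBoundedSupport.mul {f g : E ≃ₜ E} (hf : f.HasBoundedSupport)
    (hg : g.HasBoundedSupport) : (f * g).HasBoundedSupport := by
  obtain ⟨R, h⟩ := hf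
  obtain ⟨S, h'⟩ := hg
  refine ⟨max R S, fun x hx => ?_⟩
  rw [Homeomorph.mul_apply, h' x ((le_max_right _ _).trans hx), h x ((le_max_left _ _).trans hx)]

theorem Homeomorph.HasBoundedSupport.pow {f : E ≃ₜ E} (hf : f.HasBoundedSupport) (N : ℕ) :
    (f ^ N).HasBoundedSupport := by
  induction N with
  | zero => exact .one
  | succ N ih => rw [pow_succ]; exact ih.mul hf

theorem Homeomorph.HasBoundedSupport.of_dist {f : E ≃ₜ E} {q : E} {r : ℝ}
    (h : ∀ x, r ≤ dist x q → f x = x) : f.HasBoundedSupport := by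
  refine ⟨r + ‖q‖, fun x hx => h x ?_⟩
  rw [dist_eq_norm]
  linarith [norm_sub_norm_le x q]

variable [NormedSpace ℝ E]

theorem Homeomorph.conj_dilation_apply_eq {f : E ≃ₜ E} {R r : ℝ} {q : E} (hr : 0 < r)
    (h : ∀ x, R ≤ ‖x‖ → f x = x) (x : E) (hx : r * R ≤ dist x q) :
    (dilationHomeo q r hr.ne' * f * (dilationHomeo q r hr.ne')⁻¹) x = x := by
  have h1 : R ≤ ‖(dilationHomeo q r hr.ne').symm x‖ := by
    rw [dilationHomeo_symm_apply, norm_smul, norm_inv, Real.norm_of_nonneg hr.le,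
      le_inv_mul_iff₀ hr, ← dist_eq_norm]
    exact hx
  rw [Homeomorph.mul_apply, Homeomorph.mul_apply, Homeomorph.inv_apply, h _ h1,
    Homeomorph.apply_symm_apply]

theorem Homeomorph.HasBoundedSupport.conj_dilation {f : E ≃ₜ E} (hf : f.HasBoundedSupport) (q : E)
    {r : ℝ} (hr : 0 < r) :
    (dilationHomeo q r hr.ne' * f * (dilationHomeo q r hr.ne')⁻¹).HasBoundedSupport := by
  obtain ⟨R, h⟩ := hf
  exact .of_dist (Homeomorph.conj_dilation_apply_eq hr h)

/-- A homeomorphism of bounded support is conjugate to one which is supported in a given ball, by a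
homeomorphism which acts as a contraction on the support. -/
theorem Homeomorph.HasBoundedSupport.exists_conj {Γ : E ≃ₜ E} (hΓ : Γ.HasBoundedSupport) (v : E)
    {ε : ℝ} (hε : 0 < ε) : ∃ k : E ≃ₜ E, k.IsBilipschitz ∧ k.HasBoundedSupport ∧
      (∃ c δ, ∃ hδ : 0 < δ,
        k * Γ * k⁻¹ = dilationHomeo c δ hδ.ne' * Γ * (dilationHomeo c δ hδ.ne')⁻¹) ∧
      ∀ x, ε ≤ dist x v → (k * Γ * k⁻¹) x = x := by
  obtain ⟨R, hR⟩ := hΓ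
  obtain ⟨f, hf, hf1, hf2, hf3⟩ := exists_halving_homeomorph E
  obtain ⟨M, hM, hMR⟩ : ∃ M, 0 < M ∧ R + ‖v‖ ≤ M :=
    ⟨|R| + ‖v‖ + 1, by positivity, by linarith [le_abs_self R]⟩
  obtain ⟨N, hN⟩ := exists_pow_lt_of_lt_one (div_pos hε hM) (one_half_lt_one (α := ℝ))
  have hδ : 0 < (1 / 2 : ℝ) ^ N := by positivity
  have hpow : ∀ N : ℕ, (∀ x, ‖x‖ ≤ 1 → (f ^ N) x = (1 / 2 : ℝ) ^ N • x) ∧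
      ∀ x, (1 / 2) ^ N * ‖x‖ ≤ ‖(f ^ N) x‖ := by
    intro N
    induction N with
    | zero => simp
    | succ N ih =>
      refine ⟨fun x hx => ?_, fun x => ?_⟩
      · have h : ‖(1 / 2 : ℝ) ^ N • x‖ ≤ 1 := by
          rw [norm_smul, Real.norm_of_nonneg (by positivity)]
          exact mul_le_one₀ (pow_le_one₀ (by norm_num) (by norm_num)) (norm_nonneg x) hx
        rw [pow_succ', Homeomorph.mul_apply, ih.1 x hx, hf1 _ h, smul_smul, pow_succ']
      · rw [pow_succ', pow_succ', Homeomorph.mul_apply]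
        linarith [hf3 ((f ^ N) x), ih.2 x]
  set D := dilationHomeo v M hM.ne' with hD
  set S := dilationHomeo (0 : E) ((1 / 2 : ℝ) ^ N) hδ.ne' with hS
  have hΓ1 : ∀ x, 1 ≤ ‖x‖ → Γ (D x) = D x := fun x hx => hR _ <| by
    have h1 : M * 1 ≤ M * ‖x‖ := by gcongr
    have h2 := norm_sub_le (v + M • x) v
    rw [add_sub_cancel_left, norm_smul, Real.norm_of_nonneg hM.le] at h2
    rw [hD, dilationHomeo_apply]
    linarith
  -- `f ^ N` equals the dilation `S` on the unit ball, which supports `D⁻¹ * Γ * D`. Outside, `f`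
  -- expands enough relative to `S` that the conjugate by `S` fixes `f ^ N x`.
  have hcomm : f ^ N * (D⁻¹ * Γ * D) = S * (D⁻¹ * Γ * D) * S⁻¹ * f ^ N := by
    have hfix : ∀ x, 1 ≤ ‖x‖ → (D⁻¹ * Γ * D) x = x := fun x hx => by
      simp [-dilationHomeo_apply, hΓ1 x hx]
    generalize D⁻¹ * Γ * D = Γ1 at hfix
    have hSs : ∀ x, S⁻¹ x = ((1 / 2 : ℝ) ^ N)⁻¹ • x := fun x => by
      rw [Homeomorph.inv_apply, hS, dilationHomeo_symm_apply, sub_zero]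
    have hSa : ∀ x, S x = (1 / 2 : ℝ) ^ N • x := fun x => by
      rw [hS, dilationHomeo_apply, zero_add]
    ext x : 1
    simp only [Homeomorph.mul_apply, hSs, hSa]
    rcases lt_or_ge ‖x‖ 1 with hx | hx
    · have h1 : ‖Γ1 x‖ ≤ 1 := by
        by_contra! h
        rw [Γ1.injective (hfix _ h.le)] at h
        linarith
      rw [(hpow N).1 x hx.le, (hpow N).1 _ h1, inv_smul_smul₀ hδ.ne']
    · have h1 : 1 ≤ ‖((1 / 2 : ℝ) ^ N)⁻¹ • (f ^ N) x‖ := by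
        rw [norm_smul, norm_inv, Real.norm_of_nonneg hδ.le, le_inv_mul_iff₀ hδ]
        exact (by gcongr : _ ≤ _).trans ((hpow N).2 x)
      rw [hfix x hx, hfix _ h1, smul_inv_smul₀ hδ.ne']
  have hDS : D * S * D⁻¹ = dilationHomeo (v - (1 / 2 : ℝ) ^ N • v) ((1 / 2 : ℝ) ^ N) hδ.ne' := by
    ext x : 1
    simp only [hD, hS, Homeomorph.mul_apply, Homeomorph.inv_apply, dilationHomeo_symm_apply,
      dilationHomeo_apply]
    match_scalars <;> field_simp
    ring
  have hk : D * f ^ N * D⁻¹ * Γ * (D * f ^ N * D⁻¹)⁻¹ =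
      (D * S * D⁻¹) * Γ * (D * S * D⁻¹)⁻¹ := by
    calc _ = D * (f ^ N * (D⁻¹ * Γ * D)) * (f ^ N)⁻¹ * D⁻¹ := by group
      _ = _ := by rw [hcomm]; group
  refine ⟨D * f ^ N * D⁻¹, ((isBilipschitz_dilationHomeo v hM).mul (hf.pow N)).mul
    (isBilipschitz_dilationHomeo v hM).inv,
    (Homeomorph.HasBoundedSupport.pow ⟨2, hf2⟩ N).conj_dilation v hM, ⟨_, _, hδ, hDS ▸ hk⟩, ?_⟩
  intro x hx
  have h1 : 1 ≤ ‖((1 / 2 : ℝ) ^ N)⁻¹ • M⁻¹ • (x - v)‖ := by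
    rw [norm_smul, norm_smul, norm_inv, norm_inv, Real.norm_of_nonneg hδ.le,
      Real.norm_of_nonneg hM.le, le_inv_mul_iff₀ hδ, mul_one, le_inv_mul_iff₀ hM, ← dist_eq_norm]
    rw [lt_div_iff₀ hM] at hN
    linarith
  have h2 := hΓ1 _ h1
  have h3 : (D * S * D⁻¹)⁻¹ x = D (((1 / 2 : ℝ) ^ N)⁻¹ • M⁻¹ • (x - v)) := by
    have : (D * S * D⁻¹)⁻¹ = D * S⁻¹ * D⁻¹ := by group
    rw [this]
    simp [hD, hS]
  rw [hk, Homeomorph.mul_apply, Homeomorph.mul_apply, h3, h2, ← h3, Homeomorph.inv_apply,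
    Homeomorph.apply_symm_apply]

variable [CompleteSpace E] [Nontrivial E]

/-- A homeomorphism of bounded support is conjugate to a commutator of homeomorphisms supported in
a given ball. -/
theorem Homeomorph.HasBoundedSupport.exists_commutator {Γ : E ≃ₜ E} (hΓ : Γ.HasBoundedSupport)
    (q : E) {ρ : ℝ} (hρ : 0 < ρ) : ∃ k ψ φ : E ≃ₜ E,
      k * Γ * k⁻¹ = φ * ψ * φ⁻¹ * ψ⁻¹ ∧
      (∀ x, ρ ≤ dist x q → φ x = x) ∧ (∀ x, ρ ≤ dist x q → ψ x = x) ∧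
      k.HasBoundedSupport ∧ k.IsBilipschitz ∧ ψ.IsBilipschitz ∧
      (Γ.IsBilipschitz → φ.IsBilipschitz) ∧ (UniformAnnular Γ → UniformAnnular φ) := by
  obtain ⟨f, hf, hf1, hf2, hf3⟩ := exists_halving_homeomorph E
  -- `3 / 8` is the middle of the annulus of radii `5 / 16` and `7 / 16`, so the ball of radius `1 /
  -- 16` around `v` fits into it.
  obtain ⟨v, hv⟩ := exists_norm_eq E (show (0 : ℝ) ≤ 3 / 8 by norm_num)
  set A := dilationHomeo q ρ hρ.ne' with hA
  have hbA : A.IsBilipschitz := isBilipschitz_dilationHomeo q hρ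
  obtain ⟨k, hk1, hk2, ⟨c, δ, hδ, hkc⟩, hk3⟩ := hΓ.exists_conj (q + ρ • v)
    (show 0 < ρ * (1 / 16) by positivity)
  have hB := isBilipschitz_dilationHomeo c hδ
  set Γ' := A⁻¹ * (k * Γ * k⁻¹) * A with hΓ'
  have hann : FixesOffAnnulus Γ' := by
    intro x hx
    have h1 : 1 / 16 ≤ ‖x - v‖ := by
      by_contra! h
      refine hx ⟨?_, ?_⟩
      · linarith [norm_sub_norm_le v x, norm_sub_rev v x]
      · linarith [norm_sub_norm_le x v]
    have h2 : ρ * (1 / 16) ≤ dist (A x) (q + ρ • v) := by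
      rw [hA, ← dilationHomeo_apply q ρ hρ.ne' v, dist_dilationHomeo q hρ, dist_eq_norm]
      gcongr
    have h3 := hk3 _ h2
    rw [hΓ', Homeomorph.mul_apply, Homeomorph.mul_apply, h3, Homeomorph.inv_apply,
      Homeomorph.symm_apply_apply]
  have h2 : (0 : ℝ) < 1 / 2 := by norm_num
  set D := dilationHomeo (0 : E) (1 / 2) h2.ne' with hD
  set ψ := D * f * D⁻¹ with hψ
  have hψa : ∀ x, ψ x = (1 / 2 : ℝ) • f ((2 : ℝ) • x) := fun x => by
    simp [hψ, hD]
  have hψ1 : ∀ x, ‖x‖ ≤ 1 / 2 → ψ x = (1 / 2 : ℝ) • x := fun x hx => by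
    rw [hψa, hf1, smul_smul (1 / 2 : ℝ) 2]
    · norm_num
    · rw [norm_smul, Real.norm_ofNat]; linarith
  have hψ2 : ∀ x, 1 / 2 * ‖x‖ ≤ ‖ψ x‖ := fun x => by
    have := hf3 ((2 : ℝ) • x)
    rw [norm_smul, Real.norm_ofNat] at this
    rw [hψa, norm_smul, Real.norm_of_nonneg h2.le]
    linarith
  have hψ3 : ∀ x, 1 ≤ ‖x‖ → ψ x = x := fun x hx =>
    Homeomorph.conj_dilation_apply_eq h2 hf2 x (by simpa using hx)
  have hψ4 : ψ.IsBilipschitz :=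
    ((isBilipschitz_dilationHomeo 0 h2).mul hf).mul (isBilipschitz_dilationHomeo 0 h2).inv
  have hcomm := hann.repeated_commutator hψ1 hψ2
  set φ := repeatedHomeo Γ' hann with hφ
  have hφ3 : ∀ x, 1 ≤ ‖x‖ → φ x = x := fun x hx => hann.repeated_eq_self (by linarith)
  refine ⟨k, A * ψ * A⁻¹, A * φ * A⁻¹, ?_,
    fun x hx => Homeomorph.conj_dilation_apply_eq hρ hφ3 x (by simpa using hx),
    fun x hx => Homeomorph.conj_dilation_apply_eq hρ hψ3 x (by simpa using hx), hk2, hk1,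
    (hbA.mul hψ4).mul hbA.inv, fun h => ?_, fun h => ?_⟩
  · calc k * Γ * k⁻¹ = A * Γ' * A⁻¹ := by rw [hΓ']; group
      _ = _ := by rw [← hcomm]; group
  · have h3 : Γ'.IsBilipschitz := (hbA.inv.mul ((hk1.mul h).mul hk1.inv)).mul hbA
    exact (hbA.mul (h3.repeatedHomeo hann)).mul hbA.inv
  · have h3 : UniformAnnular Γ' := by
      -- Conjugation by the bilipschitz `k` need not preserve the annular condition; on `Γ` it
      -- coincides with conjugation by a dilation, which does.
      rw [hΓ', hkc]
      exact (h.conj_dilation c hδ).conj_dilation_symm q hρ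
    exact (h3.repeatedHomeo hann).conj_dilation q hρ

end Commutator

/-! ### Dilatation and the distortion of annuli -/

section Dilatation

variable {n : ℕ}

theorem eventually_dist_le_of_dilatation_lt
    {f : EuclideanSpace ℝ (Fin n) → EuclideanSpace ℝ (Fin n)} {x : EuclideanSpace ℝ (Fin n)}
    {K : ℝ≥0} (h : dilatation f x < K) :
    ∀ᶠ r in 𝓝[>] (0 : ℝ), ∀ y z, dist y x = r → dist z x = r →
      dist (f y) (f x) ≤ K * dist (f z) (f x) := by
  have hK : (K : ℝ≥0∞) ≠ 0 := (bot_le.trans_lt h).ne'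
  filter_upwards [Filter.eventually_lt_of_limsup_lt h] with r hr y z hy hz
  have h1 := (ENNReal.div_le_iff_le_mul (Or.inr ENNReal.coe_ne_top) (Or.inr hK)).1 hr.le
  have h2 : edist (f x) (f y) ≤ ⨆ y ∈ Metric.sphere x r, edist (f x) (f y) :=
    le_iSup₂ (f := fun y (_ : y ∈ Metric.sphere x r) => edist (f x) (f y)) y hy
  have h3 : ⨅ y ∈ Metric.sphere x r, edist (f x) (f y) ≤ edist (f x) (f z) := iInf₂_le z hz
  have h4 : edist (f x) (f y) ≤ K * edist (f x) (f z) :=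
    h2.trans (h1.trans (by gcongr))
  rw [edist_nndist, edist_nndist, ← ENNReal.coe_mul, ENNReal.coe_le_coe] at h4
  rw [dist_comm (f y), dist_comm (f z)]
  exact_mod_cast h4

theorem AnnularDistortion.dilatation_le
    {f : EuclideanSpace ℝ (Fin n) → EuclideanSpace ℝ (Fin n)} {x : EuclideanSpace ℝ (Fin n)}
    {K : ℝ≥0} (hK : K ≠ 0) (h : AnnularDistortion f 0 K x) : dilatation f x ≤ K := by
  obtain ⟨δ, hδ, h⟩ := Metric.eventually_nhds_iff.1 h
  refine Filter.limsup_le_of_le (by isBoundedDefault) ?_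
  filter_upwards [Ioo_mem_nhdsGT hδ] with r hr
  refine ENNReal.div_le_of_le_mul (iSup₂_le fun y hy => ?_)
  rw [mul_comm, ← ENNReal.div_le_iff_le_mul (Or.inl (by simpa using hK))
    (Or.inl ENNReal.coe_ne_top)]
  refine le_iInf₂ fun z hz => ?_
  rw [ENNReal.div_le_iff_le_mul (Or.inl (by simpa using hK)) (Or.inl ENNReal.coe_ne_top), mul_comm]
  have h1 := h (y := (y, z)) (by
    rw [Prod.dist_eq, max_lt_iff]
    exact ⟨hy.trans_lt hr.2, hz.trans_lt hr.2⟩) (by rw [hy, hz]; simp)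
  rw [edist_nndist, edist_nndist, ← ENNReal.coe_mul, ENNReal.coe_le_coe]
  rw [dist_comm _ (f x), dist_comm _ (f x)] at h1
  exact_mod_cast h1

end Dilatation

/-! ### Stereographic charts at small scales -/

section Charts

variable {n : ℕ}

theorem eventually_dist_pole (p : Sph n) {s : Sph n} (hs : s ≠ p) :
    ∀ᶠ t in 𝓝 s, t ≠ p ∧ dist s p / 2 ≤ dist t p ∧ dist t p ≤ 2 * dist s p := by
  have h : 0 < dist s p := dist_pos.2 hs
  have hc : Continuous fun t : Sph n => dist t p := by fun_prop
  filter_upwards [isOpen_ne.mem_nhds hs, hc.continuousAt.eventually_mem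
    (Ioo_mem_nhds (show dist s p / 2 < dist s p by linarith)
      (show dist s p < 2 * dist s p by linarith))] with t h1 h2
  exact ⟨h1, h2.1.le, h2.2.le⟩

theorem eventually_dist_stereoChart (p : Sph n) {s : Sph n} (hs : s ≠ p) :
    ∀ᶠ t in 𝓝 s, 2 / dist s p ^ 2 * dist t s ≤ dist (stereoChart p t) (stereoChart p s) ∧
      dist (stereoChart p t) (stereoChart p s) ≤ 8 / dist s p ^ 2 * dist t s := by
  have h : 0 < dist s p := dist_pos.2 hs
  filter_upwards [eventually_dist_pole p hs] with t ⟨ht, h1, h2⟩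
  have h3 := dist_stereoChart p ht hs
  have h4 : 0 ≤ dist (stereoChart p t) (stereoChart p s) := dist_nonneg
  rw [div_mul_eq_mul_div, div_mul_eq_mul_div, div_le_iff₀ (by positivity), le_div_iff₀ (by positivity)]
  generalize dist (stereoChart p t) (stereoChart p s) = D at *
  have e1 : D * (dist s p / 2) * dist s p ≤ D * dist t p * dist s p := by gcongr
  have e2 : D * dist t p * dist s p ≤ D * (2 * dist s p) * dist s p := by gcongr
  constructor <;> nlinarith

/-- By the exact distance formula, the error relative to the chart distance is `(dist s p - dist t
p) / dist s p`, and the triangle inequality bounds the numerator by `dist t s`. This is the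
quadratic error required by `AnnularDistortion.comp_right`. -/
theorem eventually_abs_dist_stereoChart_sub_le (p : Sph n) {s : Sph n} (hs : s ≠ p) :
    ∀ᶠ t in 𝓝 s, |dist (stereoChart p t) (stereoChart p s) - 4 / dist s p ^ 2 * dist t s| ≤
      8 / dist s p ^ 3 * dist t s ^ 2 := by
  have h : 0 < dist s p := dist_pos.2 hs
  filter_upwards [eventually_dist_pole p hs, eventually_dist_stereoChart p hs] with t ⟨ht, h1, h2⟩ h5
  have h3 := dist_stereoChart p ht hs
  have h4 : |dist s p - dist t p| ≤ dist t s := by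
    rw [dist_comm t s]; exact abs_dist_sub_le s t p
  have e : dist (stereoChart p t) (stereoChart p s) - 4 / dist s p ^ 2 * dist t s =
      dist (stereoChart p t) (stereoChart p s) * ((dist s p - dist t p) / dist s p) := by
    field_simp
    linear_combination h3
  rw [e, abs_mul, abs_div, abs_of_pos h, abs_of_nonneg dist_nonneg]
  calc _ ≤ (8 / dist s p ^ 2 * dist t s) * (dist t s / dist s p) := by gcongr; exact h5.2
    _ = _ := by field_simp

theorem continuousAt_stereoChart (p : Sph n) {s : Sph n} (hs : s ≠ p) :
    ContinuousAt (stereoChart p) s :=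
  (stereoChart p).continuousAt (by simpa using hs)

theorem eventually_dist_stereoChart_symm (p : Sph n) (X : EuclideanSpace ℝ (Fin n)) :
    ∀ᶠ Y in 𝓝 X, dist ((stereoChart p).symm X) p ^ 2 / 8 * dist Y X ≤
        dist ((stereoChart p).symm Y) ((stereoChart p).symm X) ∧
      dist ((stereoChart p).symm Y) ((stereoChart p).symm X) ≤
        dist ((stereoChart p).symm X) p ^ 2 / 2 * dist Y X := by
  have h := dist_stereoChart_symm_pole_pos p X
  filter_upwards [(continuous_stereoChart_symm p).continuousAt.eventually
    (eventually_dist_pole p (stereoChart_symm_ne p X))] with Y hY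
  obtain ⟨-, h1, h2⟩ := hY
  have h3 := dist_stereoChart_symm p Y X
  have h4 : 0 ≤ dist Y X := dist_nonneg
  generalize dist Y X = D at *
  generalize dist ((stereoChart p).symm X) p = a at *
  have e1 : D * (a / 2) * a ≤ D * dist ((stereoChart p).symm Y) p * a := by gcongr
  have e2 : D * dist ((stereoChart p).symm Y) p * a ≤ D * (2 * a) * a := by gcongr
  constructor <;> nlinarith

theorem eventually_abs_dist_stereoChart_symm_sub_le (p : Sph n) (X : EuclideanSpace ℝ (Fin n)) :
    ∀ᶠ Y in 𝓝 X, |dist ((stereoChart p).symm Y) ((stereoChart p).symm X) -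
        dist ((stereoChart p).symm X) p ^ 2 / 4 * dist Y X| ≤
      dist ((stereoChart p).symm X) p ^ 2 / 4 * dist Y X ^ 2 := by
  have h := dist_stereoChart_symm_pole_pos p X
  refine Filter.Eventually.of_forall fun Y => ?_
  have h2 := dist_stereoChart_symm p Y X
  have h3 := abs_dist_sub_le ((stereoChart p).symm Y) ((stereoChart p).symm X) p
  have h4 := dist_sph_le_two ((stereoChart p).symm Y) p
  have h0 : 0 ≤ dist Y X := dist_nonneg
  have h5 : dist ((stereoChart p).symm Y) ((stereoChart p).symm X) ≤
      dist Y X * dist ((stereoChart p).symm X) p := by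
    have : dist Y X * dist ((stereoChart p).symm Y) p * dist ((stereoChart p).symm X) p ≤
      dist Y X * 2 * dist ((stereoChart p).symm X) p := by gcongr
    nlinarith
  generalize dist ((stereoChart p).symm X) p = a at *
  generalize dist ((stereoChart p).symm Y) p = b at *
  generalize dist Y X = D at *
  have e : dist ((stereoChart p).symm Y) ((stereoChart p).symm X) - a ^ 2 / 4 * D =
      D * a / 4 * (b - a) := by linear_combination h2 / 4
  rw [e, abs_mul, abs_of_nonneg (by positivity)]
  calc _ ≤ D * a / 4 * (D * a) := by gcongr; exact h3.trans h5
    _ = _ := by ring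

end Charts

/-! ### Quasiconformal maps in the charts -/

section Quasiconformal

variable {n : ℕ}

/-- The chart condition in the definition of quasiconformal homeomorphisms of the sphere. -/
def IsChartwiseQuasiconformal (f : Sph n ≃ₜ Sph n) : Prop :=
  ∀ φ ∈ atlas (EuclideanSpace ℝ (Fin n)) (Sph n),
    ∀ ψ ∈ atlas (EuclideanSpace ℝ (Fin n)) (Sph n),
      IsLocallyQuasiconformal ((φ.symm.trans f.toOpenPartialHomeomorph).trans ψ)

theorem sphExtend_eventuallyEq (p : Sph n)
    (Φ : EuclideanSpace ℝ (Fin n) ≃ₜ EuclideanSpace ℝ (Fin n)) {s : Sph n} (hs : s ≠ p) :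
    (fun t => (stereoChart p).symm (Φ (stereoChart p t))) =ᶠ[𝓝 s] sphExtend p Φ := by
  filter_upwards [isOpen_ne.mem_nhds hs] with t ht
  rw [← sphExtend_symm_apply, stereoChart_left_inv p ht]

theorem eventually_sphExtend_eq_self (p : Sph n)
    {Φ : EuclideanSpace ℝ (Fin n) ≃ₜ EuclideanSpace ℝ (Fin n)} (hΦ : Φ.HasBoundedSupport) :
    (fun t => t) =ᶠ[𝓝 p] sphExtend p Φ := by
  obtain ⟨R, hR⟩ := hΦ
  have h1 : IsClosed ((stereoChart p).symm '' Metric.closedBall 0 R) :=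
    ((isCompact_closedBall _ _).image (continuous_stereoChart_symm p)).isClosed
  have h2 : p ∉ (stereoChart p).symm '' Metric.closedBall 0 R := by
    rintro ⟨X, -, hX⟩
    exact stereoChart_symm_ne p X hX
  filter_upwards [h1.isOpen_compl.mem_nhds h2] with t ht
  by_cases htp : t = p
  · rw [htp, sphExtend_pole]
  · rw [← stereoChart_left_inv p htp, sphExtend_symm_apply, hR]
    by_contra! h
    exact ht ⟨stereoChart p t, by simpa using h.le, stereoChart_left_inv p htp⟩

theorem UniformAnnular.sphExtend (p : Sph n)
    {Φ : EuclideanSpace ℝ (Fin n) ≃ₜ EuclideanSpace ℝ (Fin n)} (hΦ : Φ.HasBoundedSupport)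
    (h : UniformAnnular Φ) : UniformAnnular (sphExtend p Φ) := by
  intro C hC
  -- At chordal distance `a ≤ 2` from the pole, the thickness needed is `C * a ^ 2 + 10 * a`, which
  -- stays bounded up to the pole.
  obtain ⟨K, hK, h⟩ := h (4 * C + 20) (by positivity)
  refine ⟨max (4 * K) 2, by positivity, fun s => ?_⟩
  by_cases hs : s = p
  · rw [hs]
    exact ((AnnularDistortion.id C p).congr (eventually_sphExtend_eq_self p hΦ)).mono le_rfl
      (le_max_right _ _)
  have ha : 0 < dist s p := dist_pos.2 hs
  have ha2 := dist_sph_le_two s p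
  have hcs := continuousAt_stereoChart p hs
  have h1 := (h (stereoChart p s)).comp_right (C := C) hcs
    (by positivity : 0 < 4 / dist s p ^ 2) hC (by positivity)
    (eventually_abs_dist_stereoChart_sub_le p hs) (by
      generalize dist s p = a at *
      have e1 : 4 * (4 / a ^ 2 * C + 5 * (8 / a ^ 3)) = (C * a ^ 2 + 10 * a) * (4 / a ^ 2) ^ 2 := by
        field_simp
        ring
      rw [e1]
      have e2 : C * a ^ 2 ≤ C * 4 := by gcongr; nlinarith
      have e3 : C * a ^ 2 + 10 * a ≤ 4 * C + 20 := by linarith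
      gcongr)
  have hb := dist_stereoChart_symm_pole_pos p (Φ (stereoChart p s))
  have h2 := h1.comp_left (Φ.continuous.continuousAt.comp hcs) (l :=
    dist ((stereoChart p).symm (Φ (stereoChart p s))) p ^ 2 / 8) (by positivity) (by positivity)
    (eventually_dist_stereoChart_symm p _) hK
  refine (h2.mono le_rfl ?_).congr (sphExtend_eventuallyEq p Φ hs)
  refine le_trans (le_of_eq ?_) (le_max_left _ _)
  field_simp
  ring

theorem UniformAnnular.isChartwiseQuasiconformal {f : Sph n ≃ₜ Sph n} (h : UniformAnnular f) :
    IsChartwiseQuasiconformal f := by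
  intro φ hφ ψ hψ w₀ hw₀
  obtain ⟨p, rfl⟩ := (mem_atlas_sph_iff φ).1 hφ
  obtain ⟨q, rfl⟩ := (mem_atlas_sph_iff ψ).1 hψ
  have hsource : ∀ w, w ∈ (((stereoChart p).symm.trans f.toOpenPartialHomeomorph).trans
      (stereoChart q)).source ↔ f ((stereoChart p).symm w) ≠ q := fun w => by
    simp [stereoChart]
  have ha₀ := dist_stereoChart_symm_pole_pos p w₀
  set a₀ := dist ((stereoChart p).symm w₀) p
  -- Genuine spheres in the chart (`C = 0`) need thickness `80 / a ^ 2` on the sphere, and `a > a₀ /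
  -- 2` on the neighbourhood chosen below.
  obtain ⟨K, hK, h⟩ := h (320 / a₀ ^ 2) (by positivity)
  lift K to ℝ≥0 using hK
  refine ⟨{w | f ((stereoChart p).symm w) ≠ q} ∩ {w | a₀ / 2 < dist ((stereoChart p).symm w) p},
    ?_, ⟨(hsource w₀).1 hw₀, ?_⟩, fun w hw => (hsource w).2 hw.1, ?_⟩
  · have hc := continuous_stereoChart_symm p
    exact (isOpen_ne_fun (by fun_prop) (by fun_prop)).inter (isOpen_lt (by fun_prop) (by fun_prop))
  · change a₀ / 2 < a₀
    linarith
  refine ⟨4 * K + 1 + 1, fun w hw => ?_⟩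
  have hb := dist_stereoChart_symm_pole_pos p w
  have h1 := (h ((stereoChart p).symm w)).comp_right (C := 0)
    (continuous_stereoChart_symm p).continuousAt
    (by positivity : 0 < dist ((stereoChart p).symm w) p ^ 2 / 4) le_rfl (by positivity)
    (eventually_abs_dist_stereoChart_symm_sub_le p w) (by
      have hw2 : a₀ / 2 < dist ((stereoChart p).symm w) p := hw.2
      generalize dist ((stereoChart p).symm w) p = a at *
      have e : 5 * a₀ ^ 2 ≤ 20 * a ^ 2 := by nlinarith
      calc 4 * (a ^ 2 / 4 * 0 + 5 * (a ^ 2 / 4)) = (5 * a₀ ^ 2) * a ^ 2 / a₀ ^ 2 := by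
            field_simp; ring
        _ ≤ (20 * a ^ 2) * a ^ 2 / a₀ ^ 2 := by gcongr
        _ = _ := by field_simp; ring)
  have hc : 0 < dist (f ((stereoChart p).symm w)) q := dist_pos.2 hw.1
  have h2 := h1.comp_left (f.continuous.comp (continuous_stereoChart_symm p)).continuousAt
    (l := 2 / dist (f ((stereoChart p).symm w)) q ^ 2) (by positivity) (by positivity)
    (eventually_dist_stereoChart q hw.1) K.2
  have h3 : AnnularDistortion (fun y => stereoChart q (f ((stereoChart p).symm y))) 0
      ((4 * K + 1 : ℝ≥0) : ℝ) w := by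
    refine h2.mono le_rfl ?_
    push_cast
    refine le_trans (le_of_eq ?_) (le_add_of_nonneg_right zero_le_one)
    field_simp
    ring
  refine (h3.dilatation_le (by positivity)).trans_lt ?_
  rw [ENNReal.coe_lt_coe]
  exact lt_add_one _

/-- The ratio of distances to two points, in terms of the chart with one of the points as pole. -/
theorem dist_stereoChart_eq_of_dist_eq_mul (p : Sph n) {X P : EuclideanSpace ℝ (Fin n)}
    (hXP : X ≠ P) : ∃ κ : ℝ, 0 < κ ∧ ∀ t Y, dist Y X = t * dist Y P →
      (stereoChart p).symm Y ≠ (stereoChart p).symm P ∧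
      dist (stereoChart ((stereoChart p).symm P) ((stereoChart p).symm Y))
        (stereoChart ((stereoChart p).symm P) ((stereoChart p).symm X)) = κ * t := by
  have hinj := (isOpenEmbedding_stereoChart_symm p).injective
  have hX := dist_stereoChart_symm_pole_pos p X
  have hP := dist_stereoChart_symm_pole_pos p P
  have hne := hinj.ne hXP
  have hXP' : 0 < dist ((stereoChart p).symm X) ((stereoChart p).symm P) := dist_pos.2 hne
  refine ⟨4 * dist ((stereoChart p).symm X) p / (dist ((stereoChart p).symm P) p *
    dist ((stereoChart p).symm X) ((stereoChart p).symm P)), by positivity, fun t Y h => ?_⟩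
  have hYP : Y ≠ P := by
    rintro rfl
    rw [dist_self, mul_zero, dist_eq_zero] at h
    exact hXP h.symm
  refine ⟨hinj.ne hYP, ?_⟩
  have h1 := dist_stereoChart _ (hinj.ne hYP) hne
  have h2 := dist_stereoChart_symm p Y X
  have h3 := dist_stereoChart_symm p Y P
  have hY := dist_stereoChart_symm_pole_pos p Y
  have hYP' : 0 < dist ((stereoChart p).symm Y) ((stereoChart p).symm P) :=
    dist_pos.2 (hinj.ne hYP)
  rw [h] at h2
  generalize dist (stereoChart ((stereoChart p).symm P) ((stereoChart p).symm Y))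
        (stereoChart ((stereoChart p).symm P) ((stereoChart p).symm X)) = D at *
  generalize dist ((stereoChart p).symm X) p = x at *
  generalize dist ((stereoChart p).symm P) p = z at *
  generalize dist ((stereoChart p).symm Y) p = y at *
  generalize dist ((stereoChart p).symm Y) ((stereoChart p).symm X) = b at *
  generalize dist ((stereoChart p).symm Y) ((stereoChart p).symm P) = c at *
  generalize dist ((stereoChart p).symm X) ((stereoChart p).symm P) = d at *
  field_simp
  refine mul_left_cancel₀ hYP'.ne' ?_
  linear_combination z * h1 + z * h2 - t * x * h3

/-- The chart with pole `p` controls concentric spheres. The chart change that sends `P` to infinity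
is a Möbius map, which turns the Apollonian spheres of `X` and `P` into spheres centred at the image
of `X`. One fixed `P` serves all `X` near `X₀`, so the two local dilatation bounds suffice for a
common `K`. -/
theorem IsChartwiseQuasiconformal.exists_annularDistortion (hn : 2 ≤ n) (p : Sph n)
    {Γ : EuclideanSpace ℝ (Fin n) ≃ₜ EuclideanSpace ℝ (Fin n)}
    (h : IsChartwiseQuasiconformal (sphExtend p Γ)) (X₀ : EuclideanSpace ℝ (Fin n)) {C : ℝ}
    (hC : 0 ≤ C) : ∃ K, ∀ᶠ X in 𝓝 X₀, AnnularDistortion Γ C K X := by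
  have hrank : 1 < Module.rank ℝ (EuclideanSpace ℝ (Fin n)) := by
    rw [← Module.finrank_eq_rank, finrank_euclideanSpace_fin]
    exact_mod_cast hn
  have : Nontrivial (EuclideanSpace ℝ (Fin n)) := by
    rw [← rank_pos_iff_nontrivial (R := ℝ)]
    exact zero_lt_one.trans hrank
  have hΓ : ∀ X, stereoChart p (sphExtend p Γ ((stereoChart p).symm X)) = Γ X := fun X => by
    rw [sphExtend_symm_apply, stereoChart_right_inv]
  -- The thickness obtained is `1 / dist X P`; it is at least `C` because `dist X P < 3 / 2 * d₀`.
  have hd₀ : 0 < 1 / (2 * (C + 1)) := by positivity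
  set d₀ := 1 / (2 * (C + 1)) with hd₀'
  obtain ⟨v, hv⟩ := exists_norm_eq (EuclideanSpace ℝ (Fin n)) hd₀.le
  set P := X₀ + v
  have hP : dist X₀ P = d₀ := by rw [dist_self_add_right, hv]
  have hX₀P : X₀ ≠ P := dist_pos.1 (hP ▸ hd₀)
  have hinj := (isOpenEmbedding_stereoChart_symm p).injective
  set p₂ := (stereoChart p).symm P with hp₂
  obtain ⟨U₁, hU₁, hX₁, -, K₁, h₁⟩ := h _ ((mem_atlas_sph_iff _).2 ⟨p, rfl⟩) _
    ((mem_atlas_sph_iff _).2 ⟨p, rfl⟩) X₀ (by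
      simpa [stereoChart] using (show sphExtend p Γ ((stereoChart p).symm X₀) ≠ p by
        rw [sphExtend_symm_apply]; exact stereoChart_symm_ne p _))
  obtain ⟨U₂, hU₂, hX₂, -, K₂, h₂⟩ := h _ ((mem_atlas_sph_iff _).2 ⟨p₂, rfl⟩) _
    ((mem_atlas_sph_iff _).2 ⟨p, rfl⟩) (stereoChart p₂ ((stereoChart p).symm X₀)) (by
      have h3 : (stereoChart p₂).symm (stereoChart p₂ ((stereoChart p).symm X₀)) =
        (stereoChart p).symm X₀ := stereoChart_left_inv p₂ (hinj.ne hX₀P)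
      have h4 : sphExtend p Γ ((stereoChart p₂).symm
          (stereoChart p₂ ((stereoChart p).symm X₀))) ≠ p := by
        rw [h3, sphExtend_symm_apply]
        exact stereoChart_symm_ne p _
      simpa [stereoChart] using h4)
  have hcont : ContinuousAt (fun X => stereoChart p₂ ((stereoChart p).symm X)) X₀ :=
    ContinuousAt.comp (continuousAt_stereoChart p₂ (hinj.ne hX₀P))
      (continuous_stereoChart_symm p).continuousAt
  refine ⟨(max 1 (max K₁ K₂ : ℝ)) ^ 3, ?_⟩
  filter_upwards [hU₁.mem_nhds hX₁, hcont.eventually_mem (hU₂.mem_nhds hX₂),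
    Metric.ball_mem_nhds X₀ (half_pos hd₀)] with X hXU₁ hXU₂ hX
  have hXP1 : dist X P < 3 / 2 * d₀ := by
    linarith [dist_triangle X X₀ P, Metric.mem_ball.1 hX]
  have hXP : 0 < dist X P := by
    linarith [dist_triangle X₀ X P, Metric.mem_ball'.1 hX]
  refine (AnnularDistortion.of_spheres hrank (le_max_left _ _) (dist_pos.1 hXP) ?_ ?_).mono ?_
    le_rfl
  · filter_upwards [eventually_dist_le_of_dilatation_lt (h₁ X hXU₁)] with r hr y z hy hz
    have h3 := hr y z hy hz
    simp only [OpenPartialHomeomorph.coe_trans, Function.comp_apply,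
      Homeomorph.toOpenPartialHomeomorph_apply, hΓ] at h3
    refine h3.trans ?_
    gcongr
    exact (le_max_left _ _).trans (le_max_right _ _)
  · obtain ⟨κ, hκ, hκ2⟩ := dist_stereoChart_eq_of_dist_eq_mul p (dist_pos.1 hXP)
    have htend : Filter.Tendsto (fun t : ℝ => κ * t) (𝓝[>] 0) (𝓝[>] 0) := by
      refine tendsto_nhdsWithin_iff.2 ⟨?_, ?_⟩
      · refine Filter.Tendsto.mono_left ?_ nhdsWithin_le_nhds
        simpa using (continuous_const_mul κ).tendsto (0 : ℝ)
      · filter_upwards [self_mem_nhdsWithin] with t ht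
        exact mul_pos hκ ht
    filter_upwards [htend.eventually (eventually_dist_le_of_dilatation_lt (h₂ _ hXU₂))]
      with t ht y z hy hz
    obtain ⟨hy1, hy2⟩ := hκ2 t y hy
    obtain ⟨hz1, hz2⟩ := hκ2 t z hz
    have h3 := ht _ _ hy2 hz2
    simp only [OpenPartialHomeomorph.coe_trans, Function.comp_apply,
      Homeomorph.toOpenPartialHomeomorph_apply] at h3
    rw [stereoChart_left_inv p₂ hy1, stereoChart_left_inv p₂ hz1,
      stereoChart_left_inv p₂ (hinj.ne (dist_pos.1 hXP)), hΓ, hΓ, hΓ] at h3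
    refine h3.trans ?_
    gcongr
    exact (le_max_right _ _).trans (le_max_right _ _)
  · rw [le_div_iff₀ hXP]
    have h3 : d₀ * (2 * (C + 1)) = 1 := by rw [hd₀']; field_simp
    nlinarith

theorem IsChartwiseQuasiconformal.uniformAnnular (hn : 2 ≤ n) (p : Sph n)
    {Γ : EuclideanSpace ℝ (Fin n) ≃ₜ EuclideanSpace ℝ (Fin n)} (hΓ : Γ.HasBoundedSupport)
    (h : IsChartwiseQuasiconformal (sphExtend p Γ)) : UniformAnnular Γ := by
  obtain ⟨R, hR⟩ := hΓ
  intro C hC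
  have hcomp := isCompact_closedBall (0 : EuclideanSpace ℝ (Fin n)) R
  obtain ⟨K, hK, hK2⟩ := hcomp.exists_annularDistortion fun X _ => h.exists_annularDistortion hn p X hC
  refine ⟨max K 2, by positivity, fun X => ?_⟩
  by_cases hX : X ∈ Metric.closedBall 0 R
  · exact (hK2 X hX).mono le_rfl (le_max_left _ _)
  · refine ((AnnularDistortion.id C X).congr ?_).mono le_rfl (le_max_right _ _)
    filter_upwards [Metric.isClosed_closedBall.isOpen_compl.mem_nhds hX] with Y hY
    rw [hR]
    simp only [Set.mem_compl_iff, mem_closedBall_zero_iff, not_le] at hY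
    exact hY.le

end Quasiconformal

/-! ### Lipschitz maps of the sphere -/

section Lipschitz

variable {n : ℕ}

theorem dist_sq_eq_cos_sphDist (x y : Sph n) : dist x y ^ 2 = 2 - 2 * Real.cos (sphDist x y) := by
  have hx : ‖(x : EuclideanSpace ℝ (Fin (n + 1)))‖ = 1 := by simp
  have hy : ‖(y : EuclideanSpace ℝ (Fin (n + 1)))‖ = 1 := by simp
  rw [sphDist, InnerProductGeometry.cos_angle, hx, hy, Subtype.dist_eq, dist_eq_norm,
    norm_sub_sq_real, hx, hy]
  ring

theorem sphDist_nonneg (x y : Sph n) : 0 ≤ sphDist x y := InnerProductGeometry.angle_nonneg _ _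

theorem dist_le_sphDist (x y : Sph n) : dist x y ≤ sphDist x y := by
  refine (pow_le_pow_iff_left₀ dist_nonneg (sphDist_nonneg x y) two_ne_zero).1 ?_
  have := Real.one_sub_sq_div_two_le_cos (x := sphDist x y)
  rw [dist_sq_eq_cos_sphDist]
  linarith

theorem sphDist_le_two_mul_dist (x y : Sph n) : sphDist x y ≤ 2 * dist x y := by
  refine (pow_le_pow_iff_left₀ (sphDist_nonneg x y) (by positivity) two_ne_zero).1 ?_
  have h := Real.cos_le_one_sub_mul_cos_sq (x := sphDist x y) (by
    rw [abs_of_nonneg (sphDist_nonneg x y)]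
    exact InnerProductGeometry.angle_le_pi _ _)
  have h2 : 1 / 8 ≤ 2 / Real.pi ^ 2 := by
    rw [div_le_div_iff₀ (by norm_num) (by positivity)]
    nlinarith [Real.pi_pos, Real.pi_le_four]
  have h3 : 1 / 8 * sphDist x y ^ 2 ≤ 2 / Real.pi ^ 2 * sphDist x y ^ 2 := by gcongr
  rw [mul_pow, dist_sq_eq_cos_sphDist]
  linarith

/-- Lipschitz maps of the sphere, for the chordal distance. -/
theorem isSphLocallyLipschitz_iff (f : Sph n → Sph n) :
    IsSphLocallyLipschitz f ↔ ∃ L : ℝ, 0 < L ∧ ∀ x y, dist (f x) (f y) ≤ L * dist x y := by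
  constructor
  · intro h
    have h1 : LocallyLipschitzOn Set.univ f := by
      intro x _
      obtain ⟨U, hU, L, hL, hLU⟩ := h x
      refine ⟨⟨L * 2, by positivity⟩, U, mem_nhdsWithin_of_mem_nhds hU,
        LipschitzOnWith.of_dist_le_mul fun y hy z hz => ?_⟩
      calc _ ≤ sphDist (f y) (f z) := dist_le_sphDist _ _
        _ ≤ L * sphDist y z := hLU y hy z hz
        _ ≤ L * (2 * dist y z) := by gcongr; exact sphDist_le_two_mul_dist _ _
        _ = L * 2 * dist y z := by ring
    obtain ⟨K, hK⟩ := h1.exists_lipschitzOnWith_of_compact isCompact_univ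
    refine ⟨K + 1, by positivity, fun x y => ?_⟩
    refine (hK.dist_le_mul x trivial y trivial).trans ?_
    gcongr
    linarith
  · rintro ⟨L, hL, h⟩ x
    refine ⟨Set.univ, Filter.univ_mem, 2 * L, by positivity, fun y _ z _ => ?_⟩
    calc _ ≤ 2 * dist (f y) (f z) := sphDist_le_two_mul_dist _ _
      _ ≤ 2 * (L * dist y z) := by gcongr; exact h _ _
      _ ≤ 2 * (L * sphDist y z) := by gcongr; exact dist_le_sphDist _ _
      _ = _ := by ring

/-- Chordal distances are Euclidean ones weighted by the distances to the pole. The map is the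
identity near infinity, so it increases these weights at most by the factor `|R| + 1`. -/
theorem isSphLocallyLipschitz_sphExtend (p : Sph n)
    {Φ : EuclideanSpace ℝ (Fin n) ≃ₜ EuclideanSpace ℝ (Fin n)} (hΦ : Φ.HasBoundedSupport) {L : ℝ}
    (hL0 : 0 < L) (hL : ∀ X Y, dist (Φ X) (Φ Y) ≤ L * dist X Y) :
    IsSphLocallyLipschitz (sphExtend p Φ) := by
  rw [isSphLocallyLipschitz_iff]
  obtain ⟨R, hR⟩ := hΦ
  have hpole : ∀ s, dist (sphExtend p Φ s) p ≤ (|R| + 1) * dist s p := by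
    intro s
    by_cases hs : s = p
    · simp [hs, sphExtend_pole]
    rw [← stereoChart_left_inv p hs, sphExtend_symm_apply]
    generalize stereoChart p s = X
    have h1 := dist_stereoChart_symm_pole_sq p X
    have h2 := dist_stereoChart_symm_pole_sq p (Φ X)
    have h3 : ‖X‖ ^ 2 + 4 ≤ (|R| + 1) ^ 2 * (‖Φ X‖ ^ 2 + 4) := by
      have h5 := abs_nonneg R
      rcases le_total R ‖X‖ with h | h
      · rw [hR X h]
        exact le_mul_of_one_le_left (by positivity) (by nlinarith)
      · have h4 : ‖X‖ ≤ |R| := h.trans (le_abs_self R)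
        have : ‖X‖ ^ 2 ≤ |R| ^ 2 := by gcongr
        nlinarith [mul_nonneg (sq_nonneg (|R| + 1)) (sq_nonneg ‖Φ X‖)]
    refine (pow_le_pow_iff_left₀ dist_nonneg (by positivity) two_ne_zero).1 ?_
    refine le_of_mul_le_mul_right ?_ (by positivity : 0 < ‖Φ X‖ ^ 2 + 4)
    rw [h2, ← h1, mul_pow]
    have : dist ((stereoChart p).symm X) p ^ 2 * (‖X‖ ^ 2 + 4) ≤
      dist ((stereoChart p).symm X) p ^ 2 * ((|R| + 1) ^ 2 * (‖Φ X‖ ^ 2 + 4)) := by gcongr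
    linarith
  have h1R : 1 ≤ |R| + 1 := by linarith [abs_nonneg R]
  have hM : |R| + 1 ≤ (L + 1) * (|R| + 1) ^ 2 := by
    calc |R| + 1 ≤ 1 * (|R| + 1) ^ 2 := by nlinarith
      _ ≤ _ := by gcongr; linarith
  refine ⟨(L + 1) * (|R| + 1) ^ 2, by positivity, fun s t => ?_⟩
  by_cases hs : s = p
  · subst hs
    rw [sphExtend_pole, dist_comm, dist_comm s t]
    exact (hpole t).trans (by gcongr)
  by_cases ht : t = p
  · subst ht
    rw [sphExtend_pole]
    exact (hpole s).trans (by gcongr)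
  have h1 := hpole s
  have h2 := hpole t
  rw [← stereoChart_left_inv p hs, ← stereoChart_left_inv p ht] at *
  generalize stereoChart p s = X at *
  generalize stereoChart p t = Y at *
  rw [sphExtend_symm_apply, sphExtend_symm_apply] at *
  have h3 := dist_stereoChart_symm p X Y
  have h4 := dist_stereoChart_symm p (Φ X) (Φ Y)
  have h5 : dist (Φ X) (Φ Y) ≤ (L + 1) * dist X Y := (hL X Y).trans (by gcongr; linarith)
  have h6 : dist (Φ X) (Φ Y) * dist ((stereoChart p).symm (Φ X)) p *
      dist ((stereoChart p).symm (Φ Y)) p ≤ (L + 1) * dist X Y *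
      ((|R| + 1) * dist ((stereoChart p).symm X) p) *
      ((|R| + 1) * dist ((stereoChart p).symm Y) p) := by gcongr
  refine le_of_mul_le_mul_left ?_ (by norm_num : (0 : ℝ) < 4)
  rw [h4]
  refine h6.trans (le_of_eq ?_)
  linear_combination -(L + 1) * (|R| + 1) ^ 2 * h3

/-- The Lipschitz bound of the inverse, applied with the pole as one of the points, keeps images
from getting too close to the pole. This costs a factor `M` for each of the two weights. -/
theorem dist_le_of_isSphLocallyLipschitz_sphExtend (p : Sph n)
    {Γ : EuclideanSpace ℝ (Fin n) ≃ₜ EuclideanSpace ℝ (Fin n)}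
    (h : IsSphLocallyLipschitz (sphExtend p Γ)) (h' : IsSphLocallyLipschitz (sphExtend p Γ).symm) :
    ∃ L : ℝ, 0 < L ∧ ∀ X Y, dist (Γ X) (Γ Y) ≤ L * dist X Y := by
  obtain ⟨L, hL, h⟩ := (isSphLocallyLipschitz_iff _).1 h
  obtain ⟨M, hM, h'⟩ := (isSphLocallyLipschitz_iff _).1 h'
  refine ⟨L * M ^ 2, by positivity, fun X Y => ?_⟩
  have hpole : ∀ X, dist ((stereoChart p).symm X) p ≤
      M * dist ((stereoChart p).symm (Γ X)) p := fun X => by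
    have := h' (sphExtend p Γ ((stereoChart p).symm X)) (sphExtend p Γ p)
    rwa [Homeomorph.symm_apply_apply, Homeomorph.symm_apply_apply, sphExtend_pole,
      sphExtend_symm_apply] at this
  have h1 := h ((stereoChart p).symm X) ((stereoChart p).symm Y)
  rw [sphExtend_symm_apply, sphExtend_symm_apply] at h1
  have h2 := dist_stereoChart_symm p X Y
  have h3 := dist_stereoChart_symm p (Γ X) (Γ Y)
  have h4 := hpole X
  have h5 := hpole Y
  have hx := dist_stereoChart_symm_pole_pos p (Γ X)
  have hy := dist_stereoChart_symm_pole_pos p (Γ Y)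
  refine le_of_mul_le_mul_right ?_ (mul_pos hx hy)
  calc _ = 4 * dist ((stereoChart p).symm (Γ X)) ((stereoChart p).symm (Γ Y)) := by
        rw [h3]; ring
    _ ≤ L * (4 * dist ((stereoChart p).symm X) ((stereoChart p).symm Y)) := by linarith
    _ = L * (dist X Y * dist ((stereoChart p).symm X) p * dist ((stereoChart p).symm Y) p) := by
        rw [h2]
    _ ≤ L * (dist X Y * (M * dist ((stereoChart p).symm (Γ X)) p) *
        (M * dist ((stereoChart p).symm (Γ Y)) p)) := by gcongr
    _ = _ := by ring

theorem isBilipschitz_of_sphExtend (p : Sph n)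
    {Γ : EuclideanSpace ℝ (Fin n) ≃ₜ EuclideanSpace ℝ (Fin n)}
    (h : IsSphLocallyLipschitz (sphExtend p Γ)) (h' : IsSphLocallyLipschitz (sphExtend p Γ).symm) :
    Γ.IsBilipschitz := by
  have e : (sphExtend p Γ).symm = sphExtend p Γ.symm := (map_inv (sphExtend p) Γ).symm
  have e' : (sphExtend p Γ.symm).symm = sphExtend p Γ := by rw [← e, Homeomorph.symm_symm]
  obtain ⟨L, hL, h1⟩ := dist_le_of_isSphLocallyLipschitz_sphExtend p h h'
  obtain ⟨M, hM, h2⟩ := dist_le_of_isSphLocallyLipschitz_sphExtend p (Γ := Γ.symm)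
    (by rwa [← e]) (by rwa [e'])
  refine ⟨max L M, by positivity, fun X Y => (h1 X Y).trans ?_, fun X Y => (h2 X Y).trans ?_⟩
  · gcongr; exact le_max_left _ _
  · gcongr; exact le_max_right _ _

theorem Homeomorph.IsBilipschitz.isSphLocallyLipschitz_sphExtend (p : Sph n)
    {Φ : EuclideanSpace ℝ (Fin n) ≃ₜ EuclideanSpace ℝ (Fin n)} (hb : Φ.IsBilipschitz)
    (hΦ : Φ.HasBoundedSupport) : IsSphLocallyLipschitz (sphExtend p Φ) ∧
      IsSphLocallyLipschitz (sphExtend p Φ).symm := by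
  obtain ⟨L, hL, h1, h2⟩ := hb
  have e : (sphExtend p Φ).symm = sphExtend p Φ.symm := (map_inv (sphExtend p) Φ).symm
  refine ⟨_root_.isSphLocallyLipschitz_sphExtend p hΦ hL h1, ?_⟩
  rw [e]
  exact _root_.isSphLocallyLipschitz_sphExtend p hΦ.inv hL h2

end Lipschitz

/-! ### Products of four conjugates -/

section Main

variable {n : ℕ}

theorem exists_displaced_nhds (p : Sph n) {h : Sph n ≃ₜ Sph n} (hne : h ≠ 1) :
    ∃ (q : EuclideanSpace ℝ (Fin n)) (ρ : ℝ) (V : Set (Sph n)), 0 < ρ ∧ (∀ s ∈ V, h s ∉ V) ∧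
      ∀ X ∈ Metric.ball q ρ, (stereoChart p).symm X ∈ V := by
  obtain ⟨s, hsp, hs⟩ : ∃ s, s ≠ p ∧ h s ≠ s := by
    -- A homeomorphism fixing every point except possibly `p` fixes `p` as well.
    by_contra! H
    refine hne (Homeomorph.ext fun s => ?_)
    by_cases hs : s = p
    · subst hs
      by_contra h1
      exact h1 (h.injective (H _ h1))
    · exact H s hs
  obtain ⟨A, B, hA, hB, hsA, hsB, hAB⟩ := t2_separation hs.symm
  have hV : (stereoChart p).symm ⁻¹' (A ∩ h ⁻¹' B) ∈ 𝓝 (stereoChart p s) := by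
    refine (continuous_stereoChart_symm p).continuousAt.preimage_mem_nhds ?_
    rw [stereoChart_left_inv p hsp]
    exact (hA.inter (hB.preimage h.continuous)).mem_nhds ⟨hsA, hsB⟩
  obtain ⟨ρ, hρ, hball⟩ := Metric.mem_nhds_iff.1 hV
  exact ⟨_, ρ, A ∩ h ⁻¹' B, hρ, fun t ht ht' => hAB.notMem_of_mem_left ht'.1 ht.2, hball⟩

theorem sphExtend_fixes (p : Sph n) {Φ : EuclideanSpace ℝ (Fin n) ≃ₜ EuclideanSpace ℝ (Fin n)}
    {q : EuclideanSpace ℝ (Fin n)} {ρ : ℝ} {V : Set (Sph n)}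
    (hV : ∀ X ∈ Metric.ball q ρ, (stereoChart p).symm X ∈ V)
    (hΦ : ∀ X, ρ ≤ dist X q → Φ X = X) (s : Sph n) (hs : s ∉ V) : sphExtend p Φ s = s := by
  by_cases hsp : s = p
  · rw [hsp, sphExtend_pole]
  rw [← stereoChart_left_inv p hsp] at hs ⊢
  rw [sphExtend_symm_apply, hΦ]
  by_contra! h
  exact hs (hV _ h)

/-- The extension of a homeomorphism of bounded support as a product of four conjugates of a
nontrivial homeomorphism of the sphere and its inverse. -/
theorem exists_four_conjugators (hn : 2 ≤ n) (p : Sph n) {h : Sph n ≃ₜ Sph n} (hne : h ≠ 1)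
    {Γ : EuclideanSpace ℝ (Fin n) ≃ₜ EuclideanSpace ℝ (Fin n)} (hΓ : Γ.HasBoundedSupport) :
    ∃ K₀ K₁ K₂ K₃ : EuclideanSpace ℝ (Fin n) ≃ₜ EuclideanSpace ℝ (Fin n),
      (∀ K ∈ [K₀, K₁, K₂, K₃], K.HasBoundedSupport ∧ (Γ.IsBilipschitz → K.IsBilipschitz) ∧
        (UniformAnnular Γ → UniformAnnular K)) ∧
      sphExtend p Γ = sphExtend p K₀ * h * (sphExtend p K₀)⁻¹ *
        (sphExtend p K₁ * h⁻¹ * (sphExtend p K₁)⁻¹) *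
        (sphExtend p K₂ * h * (sphExtend p K₂)⁻¹) *
        (sphExtend p K₃ * h⁻¹ * (sphExtend p K₃)⁻¹) := by
  have : Nonempty (Fin n) := ⟨⟨0, by omega⟩⟩
  obtain ⟨q, ρ, V, hρ, hV, hball⟩ := exists_displaced_nhds p hne
  obtain ⟨k, ψ, φ, hk, hφ, hψ, hk1, hk2, hψ1, hφ1, hφ2⟩ := hΓ.exists_commutator q hρ
  have hφb := Homeomorph.HasBoundedSupport.of_dist hφ
  have hψb := Homeomorph.HasBoundedSupport.of_dist hψ
  have hone : UniformAnnular (1 : EuclideanSpace ℝ (Fin n) ≃ₜ EuclideanSpace ℝ (Fin n)) := .one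
  refine ⟨k⁻¹ * φ, k⁻¹, k⁻¹ * ψ, k⁻¹ * (ψ * φ), ?_, ?_⟩
  · simp only [List.mem_cons, List.not_mem_nil, or_false, forall_eq_or_imp, forall_eq]
    refine ⟨⟨hk1.inv.mul hφb, fun h => hk2.inv.mul (hφ1 h), fun h =>
      (hφ2 h).bilipschitz_mul hk2.inv⟩, ⟨hk1.inv, fun _ => hk2.inv, fun _ => ?_⟩,
      ⟨hk1.inv.mul hψb, fun _ => hk2.inv.mul hψ1, fun _ => ?_⟩,
      ⟨hk1.inv.mul (hψb.mul hφb), fun h => hk2.inv.mul (hψ1.mul (hφ1 h)), fun h =>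
      ((hφ2 h).bilipschitz_mul hψ1).bilipschitz_mul hk2.inv⟩⟩
    · simpa only [mul_one] using hone.bilipschitz_mul hk2.inv
    · simpa only [mul_one] using hone.bilipschitz_mul (hk2.inv.mul hψ1)
  · have hk' := congrArg (sphExtend p) hk
    simp only [map_mul, map_inv] at hk' ⊢
    exact eq_prod_conj_of_commutator hk' (Homeomorph.commute_conj_of_displaces hV
      (sphExtend_fixes p hball hφ) (sphExtend_fixes p hball hψ))

/-- A homeomorphism of bounded support extends to an orientation preserving homeomorphism. -/
theorem isOrientationPreserving_sphExtend (hn : 2 ≤ n) (p : Sph n) {h : Sph n ≃ₜ Sph n}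
    (hne : h ≠ 1) (hh : IsOrientationPreserving h)
    {Γ : EuclideanSpace ℝ (Fin n) ≃ₜ EuclideanSpace ℝ (Fin n)} (hΓ : Γ.HasBoundedSupport) :
    IsOrientationPreserving (sphExtend p Γ) := by
  -- The conjugators may be arbitrary homeomorphisms here, so there is no circularity in deducing
  -- orientation from this product.
  obtain ⟨K₀, K₁, K₂, K₃, -, h1⟩ := exists_four_conjugators hn p hne hΓ
  rw [← mem_orientationSubgroup] at hh ⊢
  have hN : (orientationSubgroup n).Normal := inferInstance
  rw [h1]
  have hi := inv_mem hh
  exact mul_mem (mul_mem (mul_mem (hN.conj_mem _ hh _) (hN.conj_mem _ hi _))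
    (hN.conj_mem _ hh _)) (hN.conj_mem _ hi _)

theorem exists_hasBoundedSupport_of_fixes_off_ball {g : Sph n ≃ₜ Sph n} {c : Sph n} {r : ℝ}
    (hr : r < Real.pi) (hg : ∀ x, x ∉ sphBall c r → g x = x) :
    ∃ (p : Sph n) (Γ : EuclideanSpace ℝ (Fin n) ≃ₜ EuclideanSpace ℝ (Fin n)),
      Γ.HasBoundedSupport ∧ sphExtend p Γ = g := by
  -- The antipode of the centre is at distance `π > r`. As a pole it is fixed by `g`, and the closed
  -- ball is a compact set away from it, hence bounded in the chart.
  have hc : (c : EuclideanSpace ℝ (Fin (n + 1))) ≠ 0 := ne_zero_of_mem_unit_sphere c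
  have hpc : sphDist (-c) c = Real.pi := InnerProductGeometry.angle_neg_self_of_nonzero hc
  obtain ⟨Γ, hΓ⟩ := exists_sphExtend_eq (-c) g (hg _ (by simp [sphBall, hpc, hr.le]))
  refine ⟨-c, Γ, ?_, hΓ⟩
  have hcont : Continuous fun s : Sph n => sphDist s c := by
    rw [continuous_iff_continuousAt]
    intro s
    have h1 := InnerProductGeometry.continuousAt_angle
      (x := ((s : EuclideanSpace ℝ (Fin (n + 1))), (c : EuclideanSpace ℝ (Fin (n + 1)))))
      (ne_zero_of_mem_unit_sphere s) hc
    exact h1.comp (f := fun s : Sph n => ((s : EuclideanSpace ℝ (Fin (n + 1))),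
      (c : EuclideanSpace ℝ (Fin (n + 1))))) (by fun_prop)
  have hcomp : IsCompact {s : Sph n | sphDist s c ≤ r} :=
    (isClosed_le hcont continuous_const).isCompact
  have himg : IsCompact (stereoChart (-c) '' {s : Sph n | sphDist s c ≤ r}) := by
    refine hcomp.image_of_continuousOn ((stereoChart (-c)).continuousOn.mono fun s hs => ?_)
    rw [stereoChart_source]
    rintro rfl
    exact hr.not_ge (hpc ▸ hs)
  obtain ⟨R, hR⟩ := himg.isBounded.subset_closedBall 0
  refine ⟨R + 1, fun X hX => ?_⟩
  have h1 : (stereoChart (-c)).symm X ∉ sphBall c r := fun h => by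
    have h2 := hR ⟨_, show sphDist _ c ≤ r from le_of_lt h, stereoChart_right_inv (-c) X⟩
    rw [mem_closedBall_zero_iff] at h2
    linarith
  have h2 := hg _ h1
  rw [← hΓ, sphExtend_symm_apply] at h2
  exact (isOpenEmbedding_stereoChart_symm (-c)).injective h2

end Main

theorem mainTheorem4 (n : ℕ) (hn : 2 ≤ n) (G : Set (Sph n ≃ₜ Sph n))
    (hG : G = LIP n ∨ G = QC n) (h : Sph n ≃ₜ Sph n) (hh : h ∈ G) (hne : h ≠ 1)
    (g : Sph n ≃ₜ Sph n) (hg : g ∈ supportedOnBalls G) :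
    ∃ c : Fin 4 → (Sph n ≃ₜ Sph n),
      (∀ i, IsConjIn G h (c i) ∨ IsConjIn G h⁻¹ (c i)) ∧
        g = c 0 * c 1 * c 2 * c 3 := by
  obtain ⟨hgG, B, ⟨c, r, hr, rfl⟩, hgB⟩ := hg
  obtain ⟨p, Γ, hΓ, rfl⟩ := exists_hasBoundedSupport_of_fixes_off_ball hr.2 hgB
  obtain ⟨K₀, K₁, K₂, K₃, hK, hprod⟩ := exists_four_conjugators hn p hne hΓ
  have hori : IsOrientationPreserving h := by
    rcases hG with rfl | rfl
    exacts [hh.2.2, hh.2]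
  have hmem : ∀ K ∈ [K₀, K₁, K₂, K₃], sphExtend p K ∈ G := by
    intro K hKmem
    obtain ⟨hb, hlip, huni⟩ := hK K hKmem
    have ho := isOrientationPreserving_sphExtend hn p hne hori hb
    rcases hG with rfl | rfl
    · obtain ⟨h1, h2⟩ := (hlip (isBilipschitz_of_sphExtend p hgG.1
        hgG.2.1)).isSphLocallyLipschitz_sphExtend p hb
      exact ⟨h1, h2, ho⟩
    · have h1 : IsChartwiseQuasiconformal (sphExtend p Γ) := hgG.1
      exact ⟨((huni (h1.uniformAnnular hn p hΓ)).sphExtend p hb).isChartwiseQuasiconformal, ho⟩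
  refine ⟨![_, _, _, _], fun i => ?_, hprod⟩
  fin_cases i
  · exact Or.inl ⟨_, hmem K₀ (by simp), rfl⟩
  · exact Or.inr ⟨_, hmem K₁ (by simp), rfl⟩
  · exact Or.inl ⟨_, hmem K₂ (by simp), rfl⟩
  · exact Or.inr ⟨_, hmem K₃ (by simp), rfl⟩
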